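/- Let $\mathbf k$ be a field of characteristic $0$. For $\mathbb Z$-graded vector spaces $V=\bigoplus_i V_i$ and $W=\bigoplus_i W_i$ let $C^n(V,W)$ be the space of formal sums $f=\sum_{k\ge 1} f_k$ of degree $n$ linear maps $f_k:V^{\otimes k}\to W$. On $\bigoplus_{n\in\mathbb Z} C^n(V,V)$ consider the bilinear bracket given, for $\mu\in C^m(V,V)$ and $\nu\in C^n(V,V)$, by $[\mu,\nu]=\mu\diamond\nu-(-1)^{mn}\,\nu\diamond\mu$, where for $p\ge 1$ and homogeneous $a_1,\dots,a_p$ $$(\mu\diamond\nu)_p(a_1,\dots,a_p)=\sum_{k+l=p+1}\ \sum_{i=1}^{k}(-1)^{n(|a_1|+\cdots+|a_{i-1}|)}\,\mu_k\big(a_1,\dots,a_{i-1},\nu_l(a_i,\dots,a_{i+l-1}),a_{i+l},\dots,a_p\big),$$ and $\nu\diamond\mu$ is defined in the same way, with $m$ in place of $n$ in the sign. Let $(\mathfrak A,\{\mu_k\}_{k\ge1})$ be an $A_\infty$-algebra, that is, $\mathfrak A$ is a $\mathbb Z$-graded vector space and the $\mu_k:\mathfrak A^{\otimes k}\to\mathfrak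 A$ are linear maps of degree $-1$ such that for all $n\ge1$ and homogeneous $a_1,\dots,a_n$ $$\sum_{k+l=n+1}\ \sum_{i=1}^{k}(-1)^{|a_1|+\cdots+|a_{i-1}|}\mu_k\big(a_1,\dots,a_{i-1},\mu_l(a_i,\dots,a_{i+l-1}),a_{i+l},\dots,a_n\big)=0 .$$ Let $\overline{\mathfrak A}$ be another copy of $\mathfrak A$, let $\mathcal G=\bigoplus_n C^n(\overline{\mathfrak A}\oplus\mathfrak A,\overline{\mathfrak A}\oplus\mathfrak A)$ with the bracket above, and let $\mathcal H=\bigoplus_n C^n(\overline{\mathfrak A},\mathfrak A)$, a graded subspace of $\mathcal G$ (a map is extended by zero and followed by the inclusion of $\mathfrak A$). Let $P:\mathcal G\to\mathcal H$ be the projection that restricts a map to $\overline{\mathfrak A}^{\otimes k}$ and projects its value to $\mathfrak A$. Let $\pi=\sum_k\widetilde{\mu_k}\in\mathcal G$ be the element of degree $-1$ given by $$\widetilde{\mu_k}\big((\overline{a_1},x_1),\dots,(\overline{a_k},x_k)\big)=\Big(\overline{\mu_k(a_1,\dots,a_k)},\ \sum_{p=1}^k\sum_{1\le i_1<\cdots<i_p\le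 k}\mu_k(a_1,\dots,x_{i_1},\dots,x_{i_p},\dots,a_k)\Big).$$ Then the maps $$l_k(f_1,\dots,f_k)=P[\cdots[[\pi,f_1],f_2],\dots,f_k],\qquad k\ge1,\ f_1,\dots,f_k\in\mathcal H,$$ make $\mathcal H$ an $L_\infty$-algebra: each $l_k:\mathcal H^{\otimes k}\to\mathcal H$ is linear, graded symmetric and of degree $-1$, and for all $n\ge1$ and homogeneous $f_1,\dots,f_n\in\mathcal H$ $$\sum_{i+j=n+1}\ \sum_{\sigma}\epsilon(\sigma)\,l_j\big(l_i(f_{\sigma(1)},\dots,f_{\sigma(i)}),f_{\sigma(i+1)},\dots,f_{\sigma(n)}\big)=0,$$ where $\sigma$ runs over the $(i,n-i)$-shuffles and $\epsilon(\sigma)=\epsilon(\sigma;f_1,\dots,f_n)$ is the Koszul sign. This $L_\infty$-algebra is weakly filtered by arity: for all $k\ge 1$ and $f_1,\dots,f_k\in\mathcal H$, the component of $l_k(f_1,\dots,f_k)$ on $\overline{\mathfrak A}^{\otimes p}$ vanishes for every $p<k$. -/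

import Mathlib

open scoped DirectSum

namespace DiffAInf

universe u v w v' w'

/-- The total space `⨁ i, V i` of a `ℤ`-graded vector space `V`. -/
abbrev Tot (V : ℤ → Type v) [∀ i, AddCommGroup (V i)] : Type v := ⨁ i, V i

section Graded

variable (K : Type u) [Field K]
variable (V : ℤ → Type v) [∀ i, AddCommGroup (V i)] [∀ i, Module K (V i)]
variable (W : ℤ → Type w) [∀ i, AddCommGroup (W i)] [∀ i, Module K (W i)]

/-- The homogeneous elements of degree `n` in the total space. -/
def homog (n : ℤ) : Submodule K (Tot V) := LinearMap.range (DirectSum.lof K ℤ V n)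

/-- Formal sums `∑_{k ≥ 1} φ_k` of multilinear maps `φ_k : V^{⊗ k} → W`.
The component of arity `k + 1` is stored at the index `k`. -/
abbrev Fam : Type (max v w) :=
  ∀ k : ℕ, MultilinearMap K (fun _ : Fin (k + 1) => Tot V) (Tot W)

/-- `C^n(V, W) = Hom^n(T̄(V), W)`: the formal sums all of whose components have degree `n`. -/
def cochain (n : ℤ) : Submodule K (Fam K V W) where
  carrier := {φ | ∀ (k : ℕ) (d : Fin (k + 1) → ℤ) (a : Fin (k + 1) → Tot V),
    (∀ i, a i ∈ homog K V (d i)) → φ k a ∈ homog K W ((∑ i, d i) + n)}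
  add_mem' hφ hψ k d a ha := (homog K W _).add_mem (hφ k d a ha) (hψ k d a ha)
  zero_mem' _ _ _ _ := (homog K W _).zero_mem
  smul_mem' c _ hφ k d a ha := (homog K W _).smul_mem c (hφ k d a ha)

/-- The graded vector space `⨁ n, C^n(V, W)`. -/
abbrev Cochains : Type (max v w) := ⨁ n : ℤ, cochain K V W n

/-- The operator `a ↦ (-1)^{m |a|} a` (for homogeneous `a`) on the total space. -/
def koszul (m : ℤ) : Tot V →ₗ[K] Tot V :=
  DirectSum.lmap (fun i => (m * i).negOnePow • (LinearMap.id : V i →ₗ[K] V i))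

theorem koszul_mem_homog (m n : ℤ) {a : Tot V} (ha : a ∈ homog K V n) :
    koszul K V m a ∈ homog K V n := by
  obtain ⟨x, rfl⟩ := ha
  exact ⟨_, (DirectSum.lmap_lof _ _ _).symm⟩

end Graded

section Insertion

/-- The list `(a_1, …, a_{i-1}, ν(a_i, …, a_{i+l}), a_{i+l+1}, …, a_{p+1})` of length `k + 1`
obtained by applying `ν`, of arity `l + 1`, to `l + 1` consecutive entries of a list of length
`p + 1 = k + l + 1`; the position `i` is counted from `0` in the code. -/
def insertArgs {X : Type v} {k l p : ℕ} (h : k + l = p) (i : Fin (k + 1))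
    (ν : (Fin (l + 1) → X) → X) (a : Fin (p + 1) → X) : Fin (k + 1) → X := fun j =>
  if j < i then a ⟨j, by omega⟩
  else if j = i then ν (fun t => a ⟨i + t, by omega⟩)
  else a ⟨j + l, by omega⟩

variable {K : Type u} [Field K] {X : Type v} [AddCommGroup X] [Module K X]

theorem insertArgs_update {k l p : ℕ} (h : k + l = p) (i : Fin (k + 1))
    (ν : MultilinearMap K (fun _ : Fin (l + 1) => X) X) (a : Fin (p + 1) → X) (s : Fin (p + 1)) :
    ∃ (j : Fin (k + 1)) (L : X →ₗ[K] X), ∀ x, insertArgs h i ν (Function.update a s x) =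
      Function.update (insertArgs h i ν a) j (L x) := by
  have key : ∀ (x : X) (n : ℕ) (hn : n < p + 1), n ≠ s.val →
      Function.update a s x ⟨n, hn⟩ = a ⟨n, hn⟩ := fun x n hn hne =>
    Function.update_of_ne (fun e => hne (congrArg Fin.val e)) _ _
  have key' : ∀ (x : X) (n : ℕ) (hn : n < p + 1), n = s.val →
      Function.update a s x ⟨n, hn⟩ = x := by
    rintro x n hn rfl
    simp
  by_cases h1 : s.val < i.val
  · refine ⟨⟨s, by omega⟩, LinearMap.id, fun x => funext fun j => ?_⟩
    by_cases hj : j = ⟨s.val, by omega⟩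
    · subst hj
      simp [insertArgs, Fin.lt_def, h1]
    · have hj' : j.val ≠ s.val := fun e => hj (Fin.ext e)
      rw [Function.update_of_ne hj]
      unfold insertArgs
      split_ifs with h2 h3
      · exact key _ _ _ hj'
      · congr 1
        funext t
        exact key _ _ _ (by omega)
      · refine key _ _ _ ?_
        simp only [Fin.lt_def, Fin.ext_iff] at h2 h3
        omega
  by_cases h2 : s.val ≤ i.val + l
  · refine ⟨i, ν.toLinearMap (fun t => a ⟨i + t, by omega⟩) ⟨s - i, by omega⟩,
      fun x => funext fun j => ?_⟩
    by_cases hj : j = i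
    · subst hj
      simp only [insertArgs, lt_irrefl, if_false, if_true, Function.update_self,
        MultilinearMap.toLinearMap_apply]
      congr 1
      funext t
      by_cases ht : t.val = s.val - j.val
      · rw [key' _ _ _ (by omega)]
        have e : t = ⟨s - j, by omega⟩ := Fin.ext ht
        rw [← e, Function.update_self]
      · rw [key _ _ _ (by omega), Function.update_of_ne (fun e => ht (congrArg Fin.val e))]
    · rw [Function.update_of_ne hj]
      unfold insertArgs
      have hj' : j.val ≠ i.val := fun e => hj (Fin.ext e)
      split_ifs with h3
      · simp only [Fin.lt_def] at h3
        exact key _ _ _ (by omega)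
      · simp only [Fin.lt_def] at h3
        exact key _ _ _ (by omega)
  · refine ⟨⟨s - l, by omega⟩, LinearMap.id, fun x => funext fun j => ?_⟩
    by_cases hj : j = ⟨s.val - l, by omega⟩
    · subst hj
      have e1 : ¬ ((⟨s.val - l, by omega⟩ : Fin (k + 1)) < i) := by
        simp only [Fin.lt_def]; omega
      have e2 : ¬ ((⟨s.val - l, by omega⟩ : Fin (k + 1)) = i) := by
        simp only [Fin.ext_iff]; omega
      simp only [insertArgs, if_neg e1, if_neg e2, Function.update_self, LinearMap.id_apply]
      exact key' _ _ _ (by omega)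
    · have hj' : j.val ≠ s.val - l := fun e => hj (Fin.ext e)
      rw [Function.update_of_ne hj]
      unfold insertArgs
      split_ifs with h3 h4
      · simp only [Fin.lt_def] at h3
        exact key _ _ _ (by omega)
      · congr 1
        funext t
        exact key _ _ _ (by omega)
      · exact key _ _ _ (by omega)

/-- The partial composition
`(a_1, …, a_{p+1}) ↦ μ(a_1, …, a_{i-1}, ν(a_i, …, a_{i+l}), a_{i+l+1}, …, a_{p+1})`, with no sign. -/
def insertMap {k l p : ℕ} (h : k + l = p) (i : Fin (k + 1))
    (μ : MultilinearMap K (fun _ : Fin (k + 1) => X) X)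
    (ν : MultilinearMap K (fun _ : Fin (l + 1) => X) X) :
    MultilinearMap K (fun _ : Fin (p + 1) => X) X :=
  MultilinearMap.mk' (fun a => μ (insertArgs h i ν a))
    (fun a s x y => by
      obtain ⟨j, L, hL⟩ := insertArgs_update h i ν a s
      simp [hL])
    (fun a s c x => by
      obtain ⟨j, L, hL⟩ := insertArgs_update h i ν a s
      simp [hL])

theorem insertMap_apply {k l p : ℕ} (h : k + l = p) (i : Fin (k + 1))
    (μ : MultilinearMap K (fun _ : Fin (k + 1) => X) X)
    (ν : MultilinearMap K (fun _ : Fin (l + 1) => X) X) (a : Fin (p + 1) → X) :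
    insertMap h i μ ν a = μ (insertArgs h i ν a) := rfl

theorem insertArgs_eq_update {k l p : ℕ} (h : k + l = p) (i : Fin (k + 1))
    (ν : (Fin (l + 1) → X) → X) (a : Fin (p + 1) → X) :
    insertArgs h i ν a = Function.update (insertArgs h i (fun _ => 0) a) i
      (ν (fun t => a ⟨i + t, by omega⟩)) := by
  funext j
  by_cases hj : j = i
  · subst hj
    simp [insertArgs]
  · simp [insertArgs, hj]

theorem insertMap_add_left {k l p : ℕ} (h : k + l = p) (i : Fin (k + 1))
    (μ μ' : MultilinearMap K (fun _ : Fin (k + 1) => X) X)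
    (ν : MultilinearMap K (fun _ : Fin (l + 1) => X) X) :
    insertMap h i (μ + μ') ν = insertMap h i μ ν + insertMap h i μ' ν := rfl

theorem insertMap_smul_left {k l p : ℕ} (h : k + l = p) (i : Fin (k + 1)) (c : K)
    (μ : MultilinearMap K (fun _ : Fin (k + 1) => X) X)
    (ν : MultilinearMap K (fun _ : Fin (l + 1) => X) X) :
    insertMap h i (c • μ) ν = c • insertMap h i μ ν := rfl

theorem insertMap_add_right {k l p : ℕ} (h : k + l = p) (i : Fin (k + 1))
    (μ : MultilinearMap K (fun _ : Fin (k + 1) => X) X)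
    (ν ν' : MultilinearMap K (fun _ : Fin (l + 1) => X) X) :
    insertMap h i μ (ν + ν') = insertMap h i μ ν + insertMap h i μ ν' :=
  MultilinearMap.ext fun a => by
    rw [add_apply, insertMap_apply, insertMap_apply, insertMap_apply,
      insertArgs_eq_update h i (⇑(ν + ν')), insertArgs_eq_update h i (⇑ν),
      insertArgs_eq_update h i (⇑ν'), add_apply, MultilinearMap.map_update_add]

theorem insertMap_smul_right {k l p : ℕ} (h : k + l = p) (i : Fin (k + 1)) (c : K)
    (μ : MultilinearMap K (fun _ : Fin (k + 1) => X) X)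
    (ν : MultilinearMap K (fun _ : Fin (l + 1) => X) X) :
    insertMap h i μ (c • ν) = c • insertMap h i μ ν :=
  MultilinearMap.ext fun a => by
    rw [smul_apply, insertMap_apply, insertMap_apply,
      insertArgs_eq_update h i (⇑(c • ν)), insertArgs_eq_update h i (⇑ν),
      smul_apply, MultilinearMap.map_update_smul]

theorem sum_insertArgs {k l p : ℕ} (h : k + l = p) (i : Fin (k + 1)) (n : ℤ)
    (d : Fin (p + 1) → ℤ) :
    ∑ j, insertArgs h i (fun e => (∑ t, e t) + n) d j = (∑ s, d s) + n := by
  obtain ⟨i, hi⟩ := i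
  obtain ⟨r, rfl⟩ : ∃ r, k = i + r := ⟨k - i, by omega⟩
  set d' : ℕ → ℤ := fun s => if hs : s < p + 1 then d ⟨s, hs⟩ else 0 with hd'
  have hd : ∀ s (hs : s < p + 1), d ⟨s, hs⟩ = d' s := fun s hs => by
    simp only [hd', dif_pos hs]
  have hR : ∑ s, d s = ∑ s ∈ Finset.range (p + 1), d' s := by
    rw [← Fin.sum_univ_eq_sum_range]
    exact Finset.sum_congr rfl fun s _ => hd s.1 s.2
  set e : ℕ → ℤ := fun j => if j < i then d' j
    else if j = i then (∑ t ∈ Finset.range (l + 1), d' (i + t)) + n else d' (j + l) with he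
  have hL : ∑ j, insertArgs h ⟨i, hi⟩ (fun e => (∑ t, e t) + n) d j =
      ∑ j ∈ Finset.range (i + r + 1), e j := by
    rw [← Fin.sum_univ_eq_sum_range]
    refine Finset.sum_congr rfl fun j _ => ?_
    simp only [insertArgs, he, Fin.lt_def, Fin.ext_iff, hd,
      ← Fin.sum_univ_eq_sum_range (fun t => d' (i + t)) (l + 1)]
  have e1 : ∑ j ∈ Finset.range i, e j = ∑ j ∈ Finset.range i, d' j :=
    Finset.sum_congr rfl fun j hj => by simp [he, Finset.mem_range.1 hj]
  have e2 : ∑ j ∈ Finset.range r, e (i + 1 + j) =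
      ∑ j ∈ Finset.range r, d' (i + (l + 1) + j) :=
    Finset.sum_congr rfl fun j _ => by
      have q1 : ¬ (i + 1 + j < i) := by omega
      have q2 : ¬ (i + 1 + j = i) := by omega
      simp only [he, if_neg q1, if_neg q2]
      congr 1
      omega
  have e3 : e i = (∑ t ∈ Finset.range (l + 1), d' (i + t)) + n := by simp [he]
  rw [hL, hR, show i + r + 1 = i + 1 + r by omega, show p + 1 = i + (l + 1) + r by omega,
    Finset.sum_range_add, Finset.sum_range_succ, Finset.sum_range_add _ (i + (l + 1)) r,
    Finset.sum_range_add _ i (l + 1), e1, e2, e3]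
  ring

end Insertion

section Bracket

variable (K : Type u) [Field K]
variable (V : ℤ → Type v) [∀ i, AddCommGroup (V i)] [∀ i, Module K (V i)]

/-- The map `μ ⋄ ν`, for `ν` of degree `n`, with component of arity `p + 1`
`∑ (-1)^{n (|a_1| + ⋯ + |a_{i-1}|)} μ_k(a_1, …, a_{i-1}, ν_l(a_i, …), …, a_{p+1})`,
the sum being over the positions `i` and the arities `k, l ≥ 1` with `k + l = p + 2`. -/
def diamond (n : ℤ) (μ ν : Fam K V V) : Fam K V V := fun p =>
  ∑ x : Finset.HasAntidiagonal.antidiagonal p, ∑ i : Fin (x.1.1 + 1),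
    (insertMap (Finset.HasAntidiagonal.mem_antidiagonal.1 x.2) i (μ x.1.1) (ν x.1.2)).compLinearMap
      (fun t : Fin (p + 1) => if t.val < i.val then koszul K V n else LinearMap.id)

variable {K V}

theorem insertMap_mem {m n : ℤ} {μ ν : Fam K V V} (hμ : μ ∈ cochain K V V m)
    (hν : ν ∈ cochain K V V n) {k l p : ℕ} (h : k + l = p) (i : Fin (k + 1))
    (d : Fin (p + 1) → ℤ) (a : Fin (p + 1) → Tot V) (ha : ∀ s, a s ∈ homog K V (d s)) :
    insertMap h i (μ k) (ν l) a ∈ homog K V ((∑ s, d s) + (m + n)) := by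
  have := hμ k (insertArgs h i (fun e => (∑ t, e t) + n) d) (insertArgs h i (ν l) a) (by
    intro j
    unfold insertArgs
    split_ifs
    · exact ha _
    · exact hν _ _ _ fun t => ha _
    · exact ha _)
  rw [sum_insertArgs] at this
  rw [add_comm m n, ← add_assoc]
  exact this

theorem diamond_mem {m n : ℤ} {μ ν : Fam K V V} (hμ : μ ∈ cochain K V V m)
    (hν : ν ∈ cochain K V V n) : diamond K V n μ ν ∈ cochain K V V (m + n) := by
  intro p d a ha
  simp only [diamond, sum_apply]
  refine Submodule.sum_mem _ fun x _ => Submodule.sum_mem _ fun i _ => ?_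
  refine insertMap_mem hμ hν _ i d _ fun s => ?_
  dsimp only
  split_ifs
  · exact koszul_mem_homog K V n _ (ha s)
  · exact ha s

theorem diamond_add_left (n : ℤ) (μ μ' ν : Fam K V V) :
    diamond K V n (μ + μ') ν = diamond K V n μ ν + diamond K V n μ' ν := by
  funext p
  simp only [diamond, Pi.add_apply, ← Finset.sum_add_distrib, insertMap_add_left]
  rfl

theorem diamond_smul_left (n : ℤ) (c : K) (μ ν : Fam K V V) :
    diamond K V n (c • μ) ν = c • diamond K V n μ ν := by
  funext p
  simp only [diamond, Pi.smul_apply, Finset.smul_sum, insertMap_smul_left]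
  rfl

theorem diamond_add_right (n : ℤ) (μ ν ν' : Fam K V V) :
    diamond K V n μ (ν + ν') = diamond K V n μ ν + diamond K V n μ ν' := by
  funext p
  simp only [diamond, Pi.add_apply, ← Finset.sum_add_distrib, insertMap_add_right]
  rfl

theorem diamond_smul_right (n : ℤ) (c : K) (μ ν : Fam K V V) :
    diamond K V n μ (c • ν) = c • diamond K V n μ ν := by
  funext p
  simp only [diamond, Pi.smul_apply, Finset.smul_sum, insertMap_smul_right]
  rfl

variable (K V)

/-- The bracket `⟦μ, ν⟧ = μ ⋄ ν - (-1)^{m n} ν ⋄ μ` of `μ` in `C^m(V, V)` and `ν` in `C^n(V, V)`. -/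
def bracketHom (m n : ℤ) :
    cochain K V V m →ₗ[K] cochain K V V n →ₗ[K] cochain K V V (m + n) :=
  LinearMap.mk₂ K
    (fun μ ν => ⟨diamond K V n μ ν - (m * n).negOnePow • diamond K V m ν μ,
      Submodule.sub_mem _ (diamond_mem μ.2 ν.2) (by
        have := diamond_mem ν.2 μ.2
        rw [add_comm n m] at this
        rcases Int.units_eq_one_or (m * n).negOnePow with e | e <;> rw [e] <;>
          simpa [Units.smul_def] using this)⟩)
    (fun μ μ' ν => Subtype.ext (by
      simp only [Submodule.coe_add, diamond_add_left, diamond_add_right, smul_add]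
      abel))
    (fun c μ ν => Subtype.ext (by
      simp only [Submodule.coe_smul, diamond_smul_left, diamond_smul_right, smul_sub]
      rw [smul_comm]))
    (fun μ ν ν' => Subtype.ext (by
      simp only [Submodule.coe_add, diamond_add_left, diamond_add_right, smul_add]
      abel))
    (fun c μ ν => Subtype.ext (by
      simp only [Submodule.coe_smul, diamond_smul_left, diamond_smul_right, smul_sub]
      rw [smul_comm]))

/-- The bracket on `⨁ n, C^n(V, V)`, the bilinear extension of the bracket of homogeneous
cochains. -/
def bracket : Cochains K V V →ₗ[K] Cochains K V V →ₗ[K] Cochains K V V :=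
  DirectSum.toModule K ℤ _ fun m =>
    (DirectSum.toModule K ℤ (cochain K V V m →ₗ[K] Cochains K V V) fun n =>
      ((bracketHom K V m n).compr₂
        (DirectSum.lof K ℤ (fun r => cochain K V V r) (m + n))).flip).flip

theorem bracket_lof (m n : ℤ) (μ : cochain K V V m) (ν : cochain K V V n) :
    bracket K V (DirectSum.lof K ℤ _ m μ) (DirectSum.lof K ℤ _ n ν) =
      DirectSum.lof K ℤ (fun r => cochain K V V r) (m + n) (bracketHom K V m n μ ν) := by
  simp [bracket]

end Bracket

section Functoriality

variable (K : Type u) [Field K]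
variable {V : ℤ → Type v} [∀ i, AddCommGroup (V i)] [∀ i, Module K (V i)]
variable {V' : ℤ → Type v'} [∀ i, AddCommGroup (V' i)] [∀ i, Module K (V' i)]
variable {W : ℤ → Type w} [∀ i, AddCommGroup (W i)] [∀ i, Module K (W i)]
variable {W' : ℤ → Type w'} [∀ i, AddCommGroup (W' i)] [∀ i, Module K (W' i)]

theorem lmap_mem_homog (φ : ∀ i, V i →ₗ[K] V' i) {n : ℤ} {a : Tot V} (ha : a ∈ homog K V n) :
    DirectSum.lmap φ a ∈ homog K V' n := by
  obtain ⟨x, rfl⟩ := ha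
  exact ⟨_, (DirectSum.lmap_lof _ _ _).symm⟩

/-- For linear maps `φ : V' → V` and `ψ : W → W'` of degree `0`, the map
`f ↦ ψ ∘ f ∘ (φ ⊗ ⋯ ⊗ φ)` from `C^n(V, W)` to `C^n(V', W')`. -/
def cochainMap (φ : ∀ i, V' i →ₗ[K] V i) (ψ : ∀ i, W i →ₗ[K] W' i) (n : ℤ) :
    cochain K V W n →ₗ[K] cochain K V' W' n where
  toFun f := ⟨fun k => (DirectSum.lmap ψ).compMultilinearMap
      ((f.1 k).compLinearMap fun _ => DirectSum.lmap φ),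
    fun k d _ ha => lmap_mem_homog K ψ (f.2 k d _ fun i => lmap_mem_homog K φ (ha i))⟩
  map_add' f g := Subtype.ext (funext fun k => MultilinearMap.ext fun a => by simp)
  map_smul' c f := Subtype.ext (funext fun k => MultilinearMap.ext fun a => by simp)

end Functoriality

section AInfinity

variable (K : Type u) [Field K]
variable (V : ℤ → Type v) [∀ i, AddCommGroup (V i)] [∀ i, Module K (V i)]

/-- An `A_∞`-algebra structure on the graded vector space `V`: maps `μ_k : V^{⊗ k} → V`, `k ≥ 1`, of
degree `-1` satisfying the higher associativity relations on homogeneous elements. -/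
structure AInfinityStructure where
  /-- The structure maps; `μ_{k + 1}` is stored at the index `k`. -/
  μ : cochain K V V (-1)
  /-- The relation with `p + 1` arguments. -/
  relation : ∀ (p : ℕ) (d : Fin (p + 1) → ℤ) (a : Fin (p + 1) → Tot V),
    (∀ s, a s ∈ homog K V (d s)) →
      ∑ x : Finset.HasAntidiagonal.antidiagonal p, ∑ i : Fin (x.1.1 + 1),
        (∑ s : Fin (p + 1) with s.val < i.val, d s).negOnePow •
          insertMap (Finset.HasAntidiagonal.mem_antidiagonal.1 x.2) i (μ.1 x.1.1) (μ.1 x.1.2) a = 0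

/-- The graded vector space `V̄ ⊕ V`, where `V̄` is another copy of `V`. -/
abbrev Double (i : ℤ) : Type v := V i × V i

variable {K V}

/-- The maps `μ̃_k` on `V̄ ⊕ V` with
`μ̃_k((ā_1, x_1), …, (ā_k, x_k)) = (μ_k(a_1, …, a_k), ∑_S μ_k(…))`, the sum being over the nonempty
sets `S` of positions, with `x_i` inserted at the positions `i` in `S` and `a_i` at the others. -/
def doubleFam (μ : Fam K V V) : Fam K (Double V) (Double V) := fun k =>
  (DirectSum.lmap fun i => LinearMap.inl K (V i) (V i)).compMultilinearMap
      ((μ k).compLinearMap fun _ => DirectSum.lmap fun i => LinearMap.fst K (V i) (V i)) +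
    (DirectSum.lmap fun i => LinearMap.inr K (V i) (V i)).compMultilinearMap
      (∑ S : Finset (Fin (k + 1)) with S.Nonempty,
        (μ k).compLinearMap fun s =>
          if s ∈ S then DirectSum.lmap fun i => LinearMap.snd K (V i) (V i)
          else DirectSum.lmap fun i => LinearMap.fst K (V i) (V i))

theorem doubleFam_mem {μ : Fam K V V} {n : ℤ} (hμ : μ ∈ cochain K V V n) :
    doubleFam μ ∈ cochain K (Double V) (Double V) n := by
  intro k d a ha
  refine Submodule.add_mem _ (lmap_mem_homog K _ (hμ k d _ fun i => lmap_mem_homog K _ (ha i)))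
    (lmap_mem_homog K _ ?_)
  rw [sum_apply]
  refine Submodule.sum_mem _ fun S _ => hμ k d _ fun s => ?_
  dsimp only
  split_ifs
  · exact lmap_mem_homog K _ (ha s)
  · exact lmap_mem_homog K _ (ha s)

variable (K V)

/-- The graded Lie algebra `𝒢 = ⨁ n, C^n(V̄ ⊕ V, V̄ ⊕ V)`; its bracket is `bracket K (Double V)`. -/
abbrev GSpace : Type v := Cochains K (Double V) (Double V)

/-- The graded vector space `ℋ = ⨁ n, C^n(V̄, V)`. -/
abbrev HSpace : Type v := Cochains K V V

/-- The inclusion of `ℋ` in `𝒢`: a map `V̄^{⊗ k} → V` is extended by zero to `(V̄ ⊕ V)^{⊗ k}` and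
followed by the inclusion of `V`. -/
def incl : HSpace K V →ₗ[K] GSpace K V :=
  DirectSum.lmap fun n => cochainMap K (V := V) (V' := Double V) (W := V) (W' := Double V)
    (fun i => LinearMap.fst K (V i) (V i)) (fun i => LinearMap.inr K (V i) (V i)) n

/-- The projection `P` of `𝒢` onto `ℋ`: a map is restricted to `V̄^{⊗ k}` and its value is projected
to `V`. -/
def proj : GSpace K V →ₗ[K] HSpace K V :=
  DirectSum.lmap fun n => cochainMap K (V := Double V) (V' := V) (W := Double V) (W' := V)
    (fun i => LinearMap.inl K (V i) (V i)) (fun i => LinearMap.snd K (V i) (V i)) n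

variable {K V}

/-- The element `π = ∑_k μ̃_k` of `C^{-1}(V̄ ⊕ V, V̄ ⊕ V)`. -/
def piElement (A : AInfinityStructure K V) : GSpace K V :=
  DirectSum.lof K ℤ (fun n => cochain K (Double V) (Double V) n) (-1)
    ⟨doubleFam A.μ.1, doubleFam_mem A.μ.2⟩

/-- The iterated bracket `[⋯[[π, f_1], f_2], …, f_k]` in `𝒢`. -/
def iterBracket (A : AInfinityStructure K V) : ∀ k : ℕ, (Fin k → HSpace K V) → GSpace K V
  | 0, _ => piElement A
  | k + 1, f => bracket K (Double V) (iterBracket A k fun i => f i.castSucc)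
      (incl K V (f (Fin.last k)))

end AInfinity

section LInfinity

/-- The Koszul sign `ε(σ; x_1, …, x_n)` for homogeneous `x_s` of degree `d s`: one factor
`(-1)^{|x_a| |x_b|}` for each pair whose order is reversed in `(x_{σ(1)}, …, x_{σ(n)})`. -/
def koszulSign {n : ℕ} (σ : Equiv.Perm (Fin n)) (d : Fin n → ℤ) : ℤˣ :=
  ∏ q : Fin n × Fin n with q.1 < q.2 ∧ σ q.2 < σ q.1, (d (σ q.1) * d (σ q.2)).negOnePow

/-- `σ` is an `(i, n - i)`-shuffle: `σ(1) < ⋯ < σ(i)` and `σ(i + 1) < ⋯ < σ(n)`. -/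
def IsShuffle {n : ℕ} (i : ℕ) (σ : Equiv.Perm (Fin n)) : Prop :=
  ∀ s t : Fin n, s < t → (t.val < i ∨ i ≤ s.val) → σ s < σ t

variable (K : Type u) [Field K]
variable (L : ℤ → Type v) [∀ i, AddCommGroup (L i)] [∀ i, Module K (L i)]

open Classical in
/-- `(L, {l_k})` is an `L_∞`-algebra, with all brackets graded symmetric of degree `-1`;
`l_{k + 1}` is stored at the index `k`. -/
structure IsLInfinityAlgebra (l : Fam K L L) : Prop where
  degree : l ∈ cochain K L L (-1)
  symmetric : ∀ (k : ℕ) (σ : Equiv.Perm (Fin (k + 1))) (d : Fin (k + 1) → ℤ)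
    (x : Fin (k + 1) → Tot L), (∀ s, x s ∈ homog K L (d s)) →
      l k (fun s => x (σ s)) = koszulSign σ d • l k x
  /-- The relation with `p + 1` arguments: the sum over `i + j = p + 2` and `(i, p + 1 - i)`-shuffles
  of `ε(σ) l_j(l_i(x_{σ(1)}, …, x_{σ(i)}), x_{σ(i + 1)}, …, x_{σ(p + 1)})`, where `j = y.1.1 + 1` and
  `i = y.1.2 + 1` in the code. -/
  jacobi : ∀ (p : ℕ) (d : Fin (p + 1) → ℤ) (x : Fin (p + 1) → Tot L),
    (∀ s, x s ∈ homog K L (d s)) →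
      ∑ y : Finset.HasAntidiagonal.antidiagonal p,
        ∑ σ : Equiv.Perm (Fin (p + 1)) with IsShuffle (y.1.2 + 1) σ,
          koszulSign σ d •
            insertMap (Finset.HasAntidiagonal.mem_antidiagonal.1 y.2) 0 (l y.1.1) (l y.1.2)
              (fun s => x (σ s)) = 0

end LInfinity

end DiffAInf

/-! The maps `l_k` are higher derived brackets in the sense of Voronov, and the argument has a
formal half and a concrete half. Formal half (`IsDerivedBracketData`): let `G` be a graded Lie
algebra, `ι : H → G` have abelian image, `P : G → H` satisfy `P[x, y] = P[ιPx, y] + P[x, ιPy]`, and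
`π` have degree `-1` with `[π, π] = 0` and `Pπ = 0`. Since elements of `H` commute in `G`, the
Jacobi identity lets neighbouring arguments of an iterated bracket be exchanged at the cost of a
Koszul sign; this gives graded symmetry. For the `L_∞` relation, bracket `[π, π] = 0` successively
with `f_1, …, f_n`. The Leibniz rule distributes the `f_i` over the two copies of `π`, so a signed
sum over subsets `S` of `[π_S, π_{Sᶜ}]` vanishes, where `π_S` is the iterated bracket with the `f_i`
in `S` (`nest_pi_pi`). Applying `P` turns each summand into the term of the relation for `S` plus
the one for `Sᶜ`. The total is twice the desired sum, and characteristic zero permits division by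
`2` (`sum_masks_eq_zero`). Subsets correspond to shuffles (`sum_shuffles`); the empty one drops out
because `Pπ = 0`. Concrete half (`isDerivedBracketData`): the Jacobi identity for cochains follows
from the graded pre-Lie identity for `⋄` (`diamond_preLie`). The identity for `P` comes from
splitting each inner value into its `V̄` and `V` parts (`projFam_diamond`). Finally `[π, π] = 0`
because `(a, x) ↦ a` and `(a, x) ↦ a + x` both carry `π` to `μ` and are jointly injective
(`diamond_doubleFam`). Arity bound: give `V` weight `0` and `V̄` weight `1`. Then `π` preserves the
filtration by weight and each element of `H` lowers it by one. After `k` brackets, `p < k` arguments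
of weight `1` land in negative weight, which is zero. -/

namespace DiffAInf

universe u v w v' w'

/-! ### Cochains evaluated on sequences, and the pre-Lie identity for `⋄` -/

section Sequences

variable {K : Type u} [Field K]
variable {V : ℤ → Type v} [∀ i, AddCommGroup (V i)] [∀ i, Module K (V i)]

/-- The component of arity `k + 1` of `φ`, evaluated on the first `k + 1` entries of a sequence. -/
def evalSeq (φ : Fam K V V) (k : ℕ) (a : ℕ → Tot V) : Tot V := φ k fun t => a t

theorem evalSeq_congr (φ : Fam K V V) {k : ℕ} {a b : ℕ → Tot V} (h : ∀ t ≤ k, a t = b t) :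
    evalSeq φ k a = evalSeq φ k b :=
  congrArg (φ k) (funext fun t => h t (Nat.lt_succ_iff.1 t.2))

/-- Sequences indexed by `ℕ` allow shifts such as `a (i + t)` without bound proofs. Nothing is lost,
because a finite tuple extends by zero. -/
theorem fam_ext {φ ψ : Fam K V V} (h : ∀ k a, evalSeq φ k a = evalSeq ψ k a) : φ = ψ := by
  funext k
  refine MultilinearMap.ext fun a => ?_
  have := h k (fun j => if hj : j < k + 1 then a ⟨j, hj⟩ else 0)
  simpa only [evalSeq, Fin.is_lt, dite_true, Fin.eta] using this

theorem evalSeq_update (φ : Fam K V V) (k : ℕ) (a : ℕ → Tot V) {j : ℕ} (hj : j < k + 1)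
    (x : Tot V) :
    evalSeq φ k (Function.update a j x) =
      φ k (Function.update (fun t : Fin (k + 1) => a t) ⟨j, hj⟩ x) := by
  refine congrArg (φ k) (funext fun t => ?_)
  simp [Function.update_apply, Fin.ext_iff]

theorem evalSeq_update_add (φ : Fam K V V) (k : ℕ) (a : ℕ → Tot V) {j : ℕ} (hj : j < k + 1)
    (x y : Tot V) : evalSeq φ k (Function.update a j (x + y)) =
      evalSeq φ k (Function.update a j x) + evalSeq φ k (Function.update a j y) := by
  simp only [evalSeq_update _ _ _ hj, MultilinearMap.map_update_add]

theorem evalSeq_update_sum {ι : Type*} (φ : Fam K V V) (k : ℕ) (a : ℕ → Tot V) {j : ℕ}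
    (hj : j < k + 1) (s : Finset ι) (x : ι → Tot V) :
    evalSeq φ k (Function.update a j (∑ i ∈ s, x i)) =
      ∑ i ∈ s, evalSeq φ k (Function.update a j (x i)) := by
  classical
  simp only [evalSeq_update _ _ _ hj, MultilinearMap.map_update_sum]

theorem evalSeq_update_unit (φ : Fam K V V) (k : ℕ) (a : ℕ → Tot V) {j : ℕ}
    (hj : j < k + 1) (ε : ℤˣ) (x : Tot V) :
    evalSeq φ k (Function.update a j (ε • x)) = ε • evalSeq φ k (Function.update a j x) := by
  rcases Int.units_eq_one_or ε with rfl | rfl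
  · simp
  · simp only [evalSeq_update _ _ _ hj, Units.neg_smul, one_smul]
    rw [← neg_one_smul K x, MultilinearMap.map_update_smul, neg_one_smul]

theorem koszul_koszul (m n : ℤ) (a : Tot V) :
    koszul K V m (koszul K V n a) = koszul K V (m + n) a := by
  have : koszul K V m ∘ₗ koszul K V n = koszul K V (m + n) := by
    ext i x : 2
    simp only [koszul, LinearMap.comp_apply, DirectSum.lmap_lof, LinearMap.smul_apply,
      LinearMap.id_apply, smul_smul, add_mul, Int.negOnePow_add]
  exact LinearMap.congr_fun this a

theorem koszul_of_mem_homog (m : ℤ) {n : ℤ} {a : Tot V} (ha : a ∈ homog K V n) :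
    koszul K V m a = (m * n).negOnePow • a := by
  obtain ⟨x, rfl⟩ := ha
  rw [koszul, DirectSum.lmap_lof]
  rcases Int.units_eq_one_or (m * n).negOnePow with e | e <;> simp [e]

theorem unit_smul_eq_smul {P : Type*} [AddCommGroup P] [Module K P] (ε : ℤˣ) (x : P) :
    ε • x = ((ε : ℤ) : K) • x := by
  rcases Int.units_eq_one_or ε with rfl | rfl <;> simp

theorem map_unit_smul {ι M N : Type*} [Fintype ι] [AddCommGroup M] [AddCommGroup N]
    [Module K M] [Module K N] (f : MultilinearMap K (fun _ : ι => M) N) (ε : ι → ℤˣ) (a : ι → M) :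
    f (fun i => ε i • a i) = (∏ i, ε i) • f a := by
  simp only [unit_smul_eq_smul (K := K)]
  rw [MultilinearMap.map_smul_univ]
  simp

/-- Multilinear maps on the total space agree if they do on homogeneous arguments. -/
theorem multilinear_ext_homog {N ι : Type*} [Finite ι] [AddCommGroup N] [Module K N]
    {f g : MultilinearMap K (fun _ : ι => Tot V) N}
    (h : ∀ (d : ι → ℤ) (a : ι → Tot V), (∀ i, a i ∈ homog K V (d i)) → f a = g a) : f = g := by
  refine MultilinearMap.dfinsupp_ext (κ := fun _ : ι => ℤ) (M := fun _ i => V i) fun d => ?_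
  exact MultilinearMap.ext fun x => h d _ fun i => ⟨x i, rfl⟩

theorem negOnePow_sum {ι : Type*} (s : Finset ι) (d : ι → ℤ) :
    (∑ i ∈ s, d i).negOnePow = ∏ i ∈ s, (d i).negOnePow := by
  classical
  induction s using Finset.induction_on with
  | empty => simp
  | insert i s hi ih => rw [Finset.sum_insert hi, Finset.prod_insert hi, Int.negOnePow_add, ih]

/-- The output degree exceeds the sum of the input degrees by `m`, so the sign taken on the output
differs from the sign taken on the inputs by `(-1)^{mn}`. -/
theorem map_koszul {m : ℤ} {φ : Fam K V V} (hφ : φ ∈ cochain K V V m) (n : ℤ) (k : ℕ)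
    (a : Fin (k + 1) → Tot V) :
    φ k (fun t => koszul K V n (a t)) = (m * n).negOnePow • koszul K V n (φ k a) := by
  have : (φ k).compLinearMap (fun _ => koszul K V n) =
      (m * n).negOnePow • (koszul K V n).compMultilinearMap (φ k) := by
    refine multilinear_ext_homog fun d a ha => ?_
    simp only [MultilinearMap.compLinearMap_apply, smul_apply,
      LinearMap.compMultilinearMap_apply]
    rw [koszul_of_mem_homog n (hφ k d a ha)]
    simp only [fun i => koszul_of_mem_homog n (ha i)]
    rw [map_unit_smul, smul_smul, ← negOnePow_sum, ← Int.negOnePow_add, ← Finset.mul_sum]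
    congr 1
    rw [mul_add, mul_comm m n, ← add_assoc, add_comm (n * m), add_assoc, Int.negOnePow_add,
      ← two_mul, Int.negOnePow_even (2 * (n * m)) (even_two_mul _), mul_one]
  exact congrArg (fun f => f a) this

theorem evalSeq_koszul {m : ℤ} {φ : Fam K V V} (hφ : φ ∈ cochain K V V m) (n : ℤ) (k : ℕ)
    (a : ℕ → Tot V) :
    evalSeq φ k (fun t => koszul K V n (a t)) =
      (m * n).negOnePow • koszul K V n (evalSeq φ k a) :=
  map_koszul hφ n k _

/-- The sequence obtained from `a` by applying the component of arity `l + 1` of `ν` to the entries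
from position `i` on, and the Koszul operator of degree `n` to the entries before. -/
def insertSeq (n : ℤ) (i l : ℕ) (ν : Fam K V V) (a : ℕ → Tot V) : ℕ → Tot V := fun j =>
  if j < i then koszul K V n (a j)
  else if j = i then evalSeq ν l (fun t => a (i + t))
  else a (j + l)

theorem evalSeq_diamond (n : ℤ) (μ ν : Fam K V V) (p : ℕ) (a : ℕ → Tot V) :
    evalSeq (diamond K V n μ ν) p a =
      ∑ x ∈ Finset.HasAntidiagonal.antidiagonal p, ∑ i ∈ Finset.range (x.1 + 1),
        evalSeq μ x.1 (insertSeq n i x.2 ν a) := by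
  rw [← Finset.sum_coe_sort]
  simp only [evalSeq, diamond, sum_apply]
  refine Finset.sum_congr rfl fun x _ => ?_
  rw [← Fin.sum_univ_eq_sum_range]
  refine Finset.sum_congr rfl fun i _ => ?_
  rw [MultilinearMap.compLinearMap_apply, insertMap_apply]
  congr 1
  funext j
  simp only [insertArgs, insertSeq, Fin.lt_def, Fin.ext_iff]
  split_ifs with h1 h2
  · rfl
  · simp only [evalSeq]
    congr 1
    funext t
    simp only [if_neg (show ¬ (i : ℕ) + t < i by omega)]
    rfl
  · omega
  · rfl

theorem insertSeq_eq_update (n : ℤ) (i l : ℕ) (ν : Fam K V V) (a : ℕ → Tot V) :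
    insertSeq n i l ν a = Function.update (insertSeq n i l (0 : Fam K V V) a) i
      (evalSeq ν l (fun t => a (i + t))) := by
  funext j
  by_cases h : j = i
  · subst h; simp [insertSeq]
  · simp [insertSeq, h]

/-- Here `ρ` lands inside the block consumed by `ν`. Entries before `j` are crossed by both maps,
hence the operator of degree `m + n`; entries of the block before `ρ` are crossed by `ρ` alone. -/
theorem insertSeq_nested (m n : ℤ) (μ ν ρ : Fam K V V) {k l r i j : ℕ} (hi : i ≤ l)
    (a : ℕ → Tot V) :
    evalSeq μ k (insertSeq m j l ν (insertSeq n (j + i) r ρ a)) =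
      evalSeq μ k (Function.update (insertSeq (m + n) j (l + r) (0 : Fam K V V) a) j
        (evalSeq ν l (insertSeq n i r ρ (fun t => a (j + t))))) := by
  refine evalSeq_congr _ fun s _ => ?_
  rcases lt_trichotomy s j with h | rfl | h
  · rw [Function.update_of_ne h.ne]
    simp only [insertSeq, if_pos h, if_pos (show s < j + i by omega), koszul_koszul]
  · rw [Function.update_self]
    simp only [insertSeq, lt_irrefl, if_false, if_true]
    refine evalSeq_congr _ fun t _ => ?_
    simp only [insertSeq, add_lt_add_iff_left, add_right_inj, add_assoc]
  · rw [Function.update_of_ne h.ne']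
    simp only [insertSeq, if_neg (show ¬ s < j by omega), if_neg (show ¬ s = j by omega),
      if_neg (show ¬ s + l < j + i by omega), if_neg (show ¬ s + l = j + i by omega), add_assoc]

/-- The two blocks are disjoint. On one side the operator of degree `n` acts on the arguments of
`ν`, on the other on its value; `evalSeq_koszul` supplies the sign. -/
theorem insertSeq_comm {m n : ℤ} (μ : Fam K V V) {ν ρ : Fam K V V} (hν : ν ∈ cochain K V V m)
    {k l r j i : ℕ} (hj : j < i) (hk : j < k + 1) (a : ℕ → Tot V) :
    evalSeq μ k (insertSeq m j l ν (insertSeq n (i + l) r ρ a)) =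
      (m * n).negOnePow • evalSeq μ k (insertSeq n i r ρ (insertSeq m j l ν a)) := by
  set b := insertSeq n i r ρ (insertSeq m j l ν a) with hb
  -- The entry of `b` at `j` already is this value; writing it as an update exposes it to
  -- `evalSeq_koszul`.
  have e1 : b = Function.update b j (koszul K V n (evalSeq ν l fun t => a (j + t))) := by
    rw [eq_comm, Function.update_eq_self_iff]
    simp [hb, insertSeq, hj]
  rw [e1, ← evalSeq_update_unit _ _ _ hk, ← evalSeq_koszul hν]
  refine evalSeq_congr _ fun s _ => ?_
  rcases lt_trichotomy s j with h | rfl | h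
  · rw [Function.update_of_ne h.ne]
    simp only [hb, insertSeq, if_pos h, if_pos (show s < i + l by omega),
      if_pos (show s < i by omega), koszul_koszul, add_comm m n]
  · rw [Function.update_self]
    simp only [insertSeq, lt_irrefl, if_false, if_true]
    refine evalSeq_congr _ fun t _ => ?_
    rw [if_pos (by omega)]
  · rw [Function.update_of_ne h.ne']
    simp only [hb, insertSeq, if_neg (show ¬ s < j by omega), if_neg (show ¬ s = j by omega),
      add_lt_add_iff_right, add_left_inj]
    split_ifs with h1 h2
    · rfl
    · refine evalSeq_congr _ fun t _ => ?_
      rw [if_neg (by omega), if_neg (by omega)]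
      congr 1
      omega
    · omega
    · omega
    · congr 1
      omega

/-- The sum of the terms of `(μ ⋄ ν) ⋄ ρ` in which `ρ` is inserted to the left of `ν`. -/
def leftTerms (m n : ℤ) (μ ν ρ : Fam K V V) (p : ℕ) (a : ℕ → Tot V) : Tot V :=
  ∑ x ∈ Finset.HasAntidiagonal.antidiagonal p, ∑ i ∈ Finset.range (x.1 + 1),
    ∑ y ∈ Finset.HasAntidiagonal.antidiagonal x.1, ∑ j ∈ Finset.range (y.1 + 1),
      if i < j then evalSeq μ y.1 (insertSeq m j y.2 ν (insertSeq n i x.2 ρ a)) else 0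

theorem evalSeq_diamond_diamond_right (m n : ℤ) (μ ν ρ : Fam K V V) (p : ℕ) (a : ℕ → Tot V) :
    evalSeq (diamond K V (m + n) μ (diamond K V n ν ρ)) p a =
      ∑ x ∈ Finset.HasAntidiagonal.antidiagonal p, ∑ j ∈ Finset.range (x.1 + 1),
        ∑ y ∈ Finset.HasAntidiagonal.antidiagonal x.2, ∑ i ∈ Finset.range (y.1 + 1),
          evalSeq μ x.1 (insertSeq m j y.1 ν (insertSeq n (j + i) y.2 ρ a)) := by
  rw [evalSeq_diamond]
  refine Finset.sum_congr rfl fun x _ => Finset.sum_congr rfl fun j hj => ?_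
  rw [insertSeq_eq_update, evalSeq_diamond, evalSeq_update_sum _ _ _ (Finset.mem_range.1 hj)]
  refine Finset.sum_congr rfl fun y hy => ?_
  rw [evalSeq_update_sum _ _ _ (Finset.mem_range.1 hj)]
  refine Finset.sum_congr rfl fun i hi => ?_
  rw [insertSeq_nested m n _ _ _ (Nat.lt_succ_iff.1 (Finset.mem_range.1 hi)),
    Finset.HasAntidiagonal.mem_antidiagonal.1 hy]

theorem evalSeq_diamond_diamond_left (m n : ℤ) (μ ν ρ : Fam K V V) (p : ℕ) (a : ℕ → Tot V) :
    evalSeq (diamond K V n (diamond K V m μ ν) ρ) p a =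
      ∑ x ∈ Finset.HasAntidiagonal.antidiagonal p, ∑ i ∈ Finset.range (x.1 + 1),
        ∑ y ∈ Finset.HasAntidiagonal.antidiagonal x.1, ∑ j ∈ Finset.range (y.1 + 1),
          evalSeq μ y.1 (insertSeq m j y.2 ν (insertSeq n i x.2 ρ a)) := by
  rw [evalSeq_diamond]
  refine Finset.sum_congr rfl fun x _ => Finset.sum_congr rfl fun i hi => ?_
  rw [evalSeq_diamond]

/-- In `(μ ⋄ ν) ⋄ ρ` the map `ρ` is inserted inside `ν`, to its left or to its right. The inside
terms make up `μ ⋄ (ν ⋄ ρ)`; the right terms are the left terms with `ν` and `ρ` exchanged, up to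
the sign of `insertSeq_comm`. -/
theorem associator_eq {m n : ℤ} (μ : Fam K V V) {ν : Fam K V V} (ρ : Fam K V V)
    (hν : ν ∈ cochain K V V m) (p : ℕ) (a : ℕ → Tot V) :
    evalSeq (diamond K V n (diamond K V m μ ν) ρ) p a =
      evalSeq (diamond K V (m + n) μ (diamond K V n ν ρ)) p a +
        leftTerms m n μ ν ρ p a + (m * n).negOnePow • leftTerms n m μ ρ ν p a := by
  have split : ∀ (i j l : ℕ) (z : Tot V), z = (if j ≤ i ∧ i ≤ j + l then z else 0) +
      (if i < j then z else 0) + (if j + l < i then z else 0) := by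
    intro i j l z
    by_cases h1 : i < j
    · simp [h1, show ¬ j ≤ i by omega, show ¬ j + l < i by omega]
    · by_cases h2 : j + l < i
      · simp [h1, h2, show ¬ i ≤ j + l by omega]
      · simp [h1, h2, show j ≤ i by omega, show i ≤ j + l by omega]
  rw [evalSeq_diamond_diamond_left]
  rw [Finset.sum_congr rfl fun x _ => Finset.sum_congr rfl fun i _ =>
    Finset.sum_congr rfl fun y _ => Finset.sum_congr rfl fun j _ => split i j y.2
      (evalSeq μ y.1 (insertSeq m j y.2 ν (insertSeq n i x.2 ρ a)))]
  simp only [Finset.sum_add_distrib]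
  refine congrArg₂ _ (congrArg₂ _ ?_ rfl) ?_
  · rw [evalSeq_diamond_diamond_right]
    simp only [Finset.sum_sigma']
    rw [← Finset.sum_filter]
    -- The block of `ν` starts at `j`, so `ρ` occupies position `i - j` within it; the filter `j ≤
    -- i` makes the truncated subtraction exact.
    refine Finset.sum_nbij'
      (fun x => ⟨(x.2.2.1.1, x.2.2.1.2 + x.1.2), x.2.2.2, (x.2.2.1.2, x.1.2), x.2.1 - x.2.2.2⟩)
      (fun x => ⟨(x.1.1 + x.2.2.1.1, x.2.2.1.2), x.2.1 + x.2.2.2, (x.1.1, x.2.2.1.1), x.2.1⟩) ?_ ?_ ?_ ?_ ?_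
    · rintro ⟨⟨k', r⟩, i, ⟨k, l⟩, j⟩ h
      simp at h ⊢
      omega
    · rintro ⟨⟨k, q⟩, j, ⟨l, r⟩, i⟩ h
      simp at h ⊢
      omega
    · rintro ⟨⟨k', r⟩, i, ⟨k, l⟩, j⟩ h
      simp at h ⊢
      omega
    · rintro ⟨⟨k, q⟩, j, ⟨l, r⟩, i⟩ h
      simp at h ⊢
      omega
    · rintro ⟨⟨k', r⟩, i, ⟨k, l⟩, j⟩ h
      simp at h ⊢
      rw [Nat.add_sub_cancel' (by omega)]
  · rw [leftTerms]
    simp only [Finset.sum_sigma']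
    rw [← Finset.sum_filter, ← Finset.sum_filter, Finset.smul_sum]
    -- Before `ν` contracts its `l + 1` arguments, `ρ` sits at `i`; as an argument of `μ` it sits at
    -- `i - l`, exact because `j + l < i`.
    refine Finset.sum_nbij'
      (fun x => ⟨(x.2.2.1.1 + x.1.2, x.2.2.1.2), x.2.2.2, (x.2.2.1.1, x.1.2), x.2.1 - x.2.2.1.2⟩)
      (fun x => ⟨(x.2.2.1.1 + x.1.2, x.2.2.1.2), x.2.2.2 + x.1.2, (x.2.2.1.1, x.1.2), x.2.1⟩) ?_ ?_ ?_ ?_ ?_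
    · rintro ⟨⟨k', r⟩, i, ⟨k, l⟩, j⟩ h
      simp at h ⊢
      omega
    · rintro ⟨⟨k', r⟩, i, ⟨k, l⟩, j⟩ h
      simp at h ⊢
      omega
    · rintro ⟨⟨k', r⟩, i, ⟨k, l⟩, j⟩ h
      simp at h ⊢
      omega
    · rintro ⟨⟨k', r⟩, i, ⟨k, l⟩, j⟩ h
      simp at h ⊢
      omega
    · rintro ⟨⟨k', r⟩, i, ⟨k, l⟩, j⟩ h
      simp at h ⊢
      obtain ⟨i, rfl⟩ : ∃ i', i = i' + l := ⟨i - l, by omega⟩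
      rw [insertSeq_comm μ hν (by omega) (by omega), Nat.add_sub_cancel]

/-- The associator of `⋄` is graded symmetric in its last two arguments. -/
theorem diamond_preLie {m n : ℤ} (μ : Fam K V V) {ν ρ : Fam K V V}
    (hν : ν ∈ cochain K V V m) (hρ : ρ ∈ cochain K V V n) :
    diamond K V n (diamond K V m μ ν) ρ - diamond K V (m + n) μ (diamond K V n ν ρ) =
      (m * n).negOnePow • (diamond K V m (diamond K V n μ ρ) ν -
        diamond K V (m + n) μ (diamond K V m ρ ν)) := by
  refine fam_ext fun p a => ?_
  have h1 := associator_eq (n := n) μ ρ hν p a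
  have h2 := associator_eq (n := m) μ ν hρ p a
  rw [add_comm n m, mul_comm n m] at h2
  change evalSeq _ p a - evalSeq _ p a = (m * n).negOnePow • (evalSeq _ p a - evalSeq _ p a)
  rw [h1, h2, smul_sub, smul_add, smul_add, smul_smul, Int.units_mul_self, one_smul]
  abel

end Sequences

/-! ### The graded Lie algebra of cochains -/

section GradedLie

variable {K : Type u} [Field K]
variable {V : ℤ → Type v} [∀ i, AddCommGroup (V i)] [∀ i, Module K (V i)]

theorem coe_bracketHom (m n : ℤ) (μ : cochain K V V m) (ν : cochain K V V n) :
    (bracketHom K V m n μ ν : Fam K V V) =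
      diamond K V n μ ν - (m * n).negOnePow • diamond K V m ν μ := rfl

theorem diamond_sub_left (n : ℤ) (μ μ' ν : Fam K V V) :
    diamond K V n (μ - μ') ν = diamond K V n μ ν - diamond K V n μ' ν := by
  rw [eq_sub_iff_add_eq, ← diamond_add_left, sub_add_cancel]

theorem diamond_sub_right (n : ℤ) (μ ν ν' : Fam K V V) :
    diamond K V n μ (ν - ν') = diamond K V n μ ν - diamond K V n μ ν' := by
  rw [eq_sub_iff_add_eq, ← diamond_add_right, sub_add_cancel]

theorem diamond_unit_smul_left (n : ℤ) (ε : ℤˣ) (μ ν : Fam K V V) :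
    diamond K V n (ε • μ) ν = ε • diamond K V n μ ν := by
  rw [unit_smul_eq_smul (K := K) ε μ, diamond_smul_left]
  exact (unit_smul_eq_smul (K := K) (P := Fam K V V) ε _).symm

theorem diamond_unit_smul_right (n : ℤ) (ε : ℤˣ) (μ ν : Fam K V V) :
    diamond K V n μ (ε • ν) = ε • diamond K V n μ ν := by
  rw [unit_smul_eq_smul (K := K) ε ν, diamond_smul_right]
  exact (unit_smul_eq_smul (K := K) (P := Fam K V V) ε _).symm

theorem bracketHom_skew (m n : ℤ) (μ : cochain K V V m) (ν : cochain K V V n) :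
    (bracketHom K V m n μ ν : Fam K V V) =
      -((m * n).negOnePow • (bracketHom K V n m ν μ : Fam K V V)) := by
  rw [coe_bracketHom, coe_bracketHom, mul_comm n m, smul_sub, smul_smul, Int.units_mul_self,
    one_smul, neg_sub]

/-- The graded commutator of a graded pre-Lie product satisfies the Jacobi identity. The equation is
stated between families because the degrees of the three terms agree only propositionally. -/
theorem bracketHom_jacobi (l m n : ℤ) (x : cochain K V V l) (y : cochain K V V m)
    (z : cochain K V V n) :
    (bracketHom K V (l + m) n (bracketHom K V l m x y) z : Fam K V V) =
      (bracketHom K V l (m + n) x (bracketHom K V m n y z) : Fam K V V) +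
        (m * n).negOnePow •
          (bracketHom K V (l + n) m (bracketHom K V l n x z) y : Fam K V V) := by
  have h1 := diamond_preLie x.1 y.2 z.2
  have h2 := diamond_preLie y.1 x.2 z.2
  have h3 := diamond_preLie z.1 x.2 y.2
  simp only [coe_bracketHom, diamond_sub_left, diamond_sub_right, diamond_unit_smul_left,
    diamond_unit_smul_right, smul_sub, smul_smul, add_mul, mul_add, Int.negOnePow_add]
  rw [mul_comm n m]
  -- Only the three signs matter. In each of the eight cases the claim is a combination of the three
  -- pre-Lie identities with coefficients `±1`.
  rcases Int.units_eq_one_or (l * m).negOnePow with e1 | e1 <;>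
  rcases Int.units_eq_one_or (l * n).negOnePow with e2 | e2 <;>
  rcases Int.units_eq_one_or (m * n).negOnePow with e3 | e3 <;>
  · simp only [e1, e2, e3, one_smul, Units.neg_smul, mul_one, mul_neg, neg_neg] at h1 h2 h3 ⊢
    first
    | linear_combination (norm := module) h1 - h2 + h3
    | linear_combination (norm := module) h1 - h2 - h3
    | linear_combination (norm := module) h1 + h2 + h3
    | linear_combination (norm := module) h1 + h2 - h3

variable (K V) in
/-- The graded vector space `⨁ n, C^n(V, V)`, as the total space of the family of the `C^n(V, V)`. -/
abbrev CochainTot : Type v := Tot fun r : ℤ => cochain K V V r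

variable (K V) in
/-- The bracket on `CochainTot K V`. -/
def totBracket : CochainTot K V →ₗ[K] CochainTot K V →ₗ[K] CochainTot K V := bracket K V

theorem totBracket_lof (m n : ℤ) (μ : cochain K V V m) (ν : cochain K V V n) :
    totBracket K V (DirectSum.lof K ℤ (fun r => cochain K V V r) m μ)
      (DirectSum.lof K ℤ (fun r => cochain K V V r) n ν) =
      DirectSum.lof K ℤ (fun r => cochain K V V r) (m + n) (bracketHom K V m n μ ν) :=
  bracket_lof K V m n μ ν

/-- A homogeneous element of `CochainTot K V`. -/
def ofCochain (n : ℤ) (φ : Fam K V V) (h : φ ∈ cochain K V V n) : CochainTot K V :=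
  DirectSum.lof K ℤ (fun r => cochain K V V r) n ⟨φ, h⟩

theorem exists_ofCochain {n : ℤ} {x : CochainTot K V}
    (hx : x ∈ homog K (fun r => cochain K V V r) n) : ∃ φ h, x = ofCochain n φ h := by
  obtain ⟨y, rfl⟩ := hx
  exact ⟨y.1, y.2, rfl⟩

theorem ofCochain_mem (n : ℤ) (φ : Fam K V V) (h : φ ∈ cochain K V V n) :
    ofCochain n φ h ∈ homog K (fun r => cochain K V V r) n := ⟨_, rfl⟩

/-- Transports a homogeneous element along a propositional equality of degrees such as `l + (m + n)
= l + m + n`. -/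
theorem ofCochain_congr {m n : ℤ} (h : m = n) {φ ψ : Fam K V V} (hφ : φ ∈ cochain K V V m)
    (e : φ = ψ) : ofCochain m φ hφ = ofCochain n ψ (h ▸ e ▸ hφ) := by
  subst h e
  rfl

theorem ofCochain_add {n : ℤ} {φ ψ : Fam K V V} (hφ : φ ∈ cochain K V V n)
    (hψ : ψ ∈ cochain K V V n) :
    ofCochain n φ hφ + ofCochain n ψ hψ = ofCochain n (φ + ψ) (add_mem hφ hψ) :=
  (map_add (DirectSum.lof K ℤ (fun r => cochain K V V r) n) ⟨φ, hφ⟩ ⟨ψ, hψ⟩).symm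

theorem ofCochain_neg {n : ℤ} {φ : Fam K V V} (hφ : φ ∈ cochain K V V n) :
    -ofCochain n φ hφ = ofCochain n (-φ) (neg_mem hφ) := by
  refine neg_eq_of_add_eq_zero_right ?_
  rw [ofCochain_add, ofCochain_congr rfl _ (add_neg_cancel φ)]
  exact map_zero (DirectSum.lof K ℤ (fun r => cochain K V V r) n)

theorem unit_smul_mem {M : Type*} [AddCommGroup M] [Module K M] (S : Submodule K M) (ε : ℤˣ)
    {x : M} (hx : x ∈ S) : ε • x ∈ S := by
  rw [unit_smul_eq_smul (K := K)]
  exact S.smul_mem _ hx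

theorem map_unit_smul_linear {M N : Type*} [AddCommGroup M] [Module K M] [AddCommGroup N]
    [Module K N] (f : M →ₗ[K] N) (ε : ℤˣ) (x : M) : f (ε • x) = ε • f x := by
  rw [unit_smul_eq_smul (K := K), map_smul, ← unit_smul_eq_smul]

theorem ofCochain_unit_smul {n : ℤ} (ε : ℤˣ) {φ : Fam K V V} (hφ : φ ∈ cochain K V V n) :
    ε • ofCochain n φ hφ = ofCochain n (ε • φ) (unit_smul_mem _ ε hφ) := by
  rcases Int.units_eq_one_or ε with rfl | rfl
  · simp
  · simp only [Units.neg_smul, one_smul, ofCochain_neg]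

theorem totBracket_ofCochain {m n : ℤ} {φ ψ : Fam K V V} (hφ : φ ∈ cochain K V V m)
    (hψ : ψ ∈ cochain K V V n) :
    totBracket K V (ofCochain m φ hφ) (ofCochain n ψ hψ) =
      ofCochain (m + n) (bracketHom K V m n ⟨φ, hφ⟩ ⟨ψ, hψ⟩).1
        (bracketHom K V m n ⟨φ, hφ⟩ ⟨ψ, hψ⟩).2 :=
  totBracket_lof m n _ _

theorem totBracket_mem {m n : ℤ} {x y : CochainTot K V}
    (hx : x ∈ homog K (fun r => cochain K V V r) m)
    (hy : y ∈ homog K (fun r => cochain K V V r) n) :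
    totBracket K V x y ∈ homog K (fun r => cochain K V V r) (m + n) := by
  obtain ⟨φ, hφ, rfl⟩ := exists_ofCochain hx
  obtain ⟨ψ, hψ, rfl⟩ := exists_ofCochain hy
  rw [totBracket_ofCochain]
  exact ofCochain_mem _ _ _

theorem totBracket_skew {m n : ℤ} {x y : CochainTot K V}
    (hx : x ∈ homog K (fun r => cochain K V V r) m)
    (hy : y ∈ homog K (fun r => cochain K V V r) n) :
    totBracket K V x y = -((m * n).negOnePow • totBracket K V y x) := by
  obtain ⟨φ, hφ, rfl⟩ := exists_ofCochain hx
  obtain ⟨ψ, hψ, rfl⟩ := exists_ofCochain hy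
  simp only [totBracket_ofCochain, ofCochain_unit_smul, ofCochain_neg]
  rw [ofCochain_congr (add_comm n m) _ rfl]
  exact ofCochain_congr rfl _ (bracketHom_skew m n ⟨φ, hφ⟩ ⟨ψ, hψ⟩)

theorem totBracket_jacobi {l m n : ℤ} {x y z : CochainTot K V}
    (hx : x ∈ homog K (fun r => cochain K V V r) l)
    (hy : y ∈ homog K (fun r => cochain K V V r) m)
    (hz : z ∈ homog K (fun r => cochain K V V r) n) :
    totBracket K V (totBracket K V x y) z = totBracket K V x (totBracket K V y z) +
      (m * n).negOnePow • totBracket K V (totBracket K V x z) y := by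
  obtain ⟨φ, hφ, rfl⟩ := exists_ofCochain hx
  obtain ⟨ψ, hψ, rfl⟩ := exists_ofCochain hy
  obtain ⟨χ, hχ, rfl⟩ := exists_ofCochain hz
  simp only [totBracket_ofCochain, ofCochain_unit_smul]
  rw [ofCochain_congr (show l + (m + n) = l + m + n by ring) _ rfl,
    ofCochain_congr (show l + n + m = l + m + n by ring) _ rfl, ofCochain_add]
  exact ofCochain_congr rfl _ (bracketHom_jacobi l m n ⟨φ, hφ⟩ ⟨ψ, hψ⟩ ⟨χ, hχ⟩)

end GradedLie

/-! ### Koszul signs of permutations and of masks (subsets of positions) -/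

section Signs

theorem koszulSign_one {n : ℕ} (d : Fin n → ℤ) : koszulSign 1 d = 1 := by
  refine Finset.prod_eq_one fun q hq => ?_
  have := (Finset.mem_filter.1 hq).2
  exact absurd this.1 (not_lt_of_gt this.2)

/-- An adjacent transposition preserves the order of every pair of positions except the one it
exchanges, so only that pair changes its contribution. -/
theorem koszulSign_mul_swap {n : ℕ} (σ : Equiv.Perm (Fin (n + 1))) (i : Fin n)
    (d : Fin (n + 1) → ℤ) :
    koszulSign (σ * Equiv.swap i.castSucc i.succ) d =
      koszulSign σ d * (d (σ i.castSucc) * d (σ i.succ)).negOnePow := by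
  set s := Equiv.swap i.castSucc i.succ with hs
  set F : Equiv.Perm (Fin (n + 1)) → Fin (n + 1) × Fin (n + 1) → ℤˣ := fun τ q =>
    if q.1 < q.2 ∧ τ q.2 < τ q.1 then (d (τ q.1) * d (τ q.2)).negOnePow else 1 with hF
  have hk : ∀ τ, koszulSign τ d = ∏ q, F τ q := fun τ => by
    rw [koszulSign, Finset.prod_filter]
  have s1 : s i.castSucc = i.succ := Equiv.swap_apply_left _ _
  have s2 : s i.succ = i.castSucc := Equiv.swap_apply_right _ _
  have hlt : i.castSucc < i.succ := Fin.castSucc_lt_succ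
  have key : ∀ q, F (σ * s) q = F σ (s q.1, s q.2) *
      ((if q = (i.castSucc, i.succ) then F (σ * s) (i.castSucc, i.succ) else 1) *
        (if q = (i.succ, i.castSucc) then F σ (i.castSucc, i.succ) else 1)) := by
    rintro ⟨a, b⟩
    by_cases h1 : (a, b) = (i.castSucc, i.succ)
    · rw [if_pos h1, h1, if_neg (by simp [Fin.ext_iff])]
      simp [hF, s1, s2, hlt.not_gt]
    by_cases h2 : (a, b) = (i.succ, i.castSucc)
    · rw [if_neg h1, if_pos h2, h2]
      simp only [s1, s2, one_mul, Int.units_mul_self]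
      simp [hF, hlt.not_gt]
    rw [if_neg h1, if_neg h2, mul_one, mul_one]
    have : a < b ↔ s a < s b := by
      simp only [Prod.mk.injEq, Fin.ext_iff, Fin.val_castSucc, Fin.val_succ] at h1 h2
      simp only [hs, Equiv.swap_apply_def, Fin.ext_iff, Fin.lt_def, Fin.val_castSucc, Fin.val_succ]
      split_ifs <;> simp only [Fin.val_castSucc, Fin.val_succ] <;> omega
    simp only [hF, this, Equiv.Perm.mul_apply]
  rw [hk, hk, Finset.prod_congr rfl fun q _ => key q, Finset.prod_mul_distrib,
    Finset.prod_mul_distrib, Finset.prod_ite_eq' , Finset.prod_ite_eq',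
    if_pos (Finset.mem_univ _), if_pos (Finset.mem_univ _)]
  congr 1
  · exact (Equiv.prodCongr s s).prod_comp (F σ)
  -- Exactly one of `σ` and `σ * s` inverts the pair, so exactly one of the two correction factors
  -- is the sign and the other is `1`.
  · have hne : σ i.castSucc ≠ σ i.succ := fun e => hlt.ne (σ.injective e)
    simp only [hF, hlt, true_and, Equiv.Perm.mul_apply, s1, s2]
    rcases lt_or_gt_of_ne hne with h | h
    · simp [h, h.not_gt, mul_comm]
    · simp [h, h.not_gt]

/-- The sum of the degrees of the positions selected by the mask `b`. -/
def maskDegree {n : ℕ} (b : Fin n → Bool) (d : Fin n → ℤ) : ℤ := ∑ i, if b i then d i else 0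

/-- The Koszul sign of moving the entries selected by the mask `b` in front of the others. -/
def maskSign {n : ℕ} (b : Fin n → Bool) (d : Fin n → ℤ) : ℤˣ :=
  ∏ c, ∏ a, if a < c ∧ b c = true ∧ b a = false then (d a * d c).negOnePow else 1

/-- The complementary mask. -/
def maskNot {n : ℕ} (b : Fin n → Bool) : Fin n → Bool := fun i => !b i

theorem maskNot_maskNot {n : ℕ} (b : Fin n → Bool) : maskNot (maskNot b) = b := by
  funext i; simp [maskNot]

theorem maskNot_snoc {n : ℕ} (b : Fin n → Bool) (t : Bool) :
    maskNot (Fin.snoc b t : Fin (n + 1) → Bool) = Fin.snoc (maskNot b) (!t) := by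
  funext i
  refine Fin.lastCases ?_ (fun i => ?_) i <;> simp [maskNot]

/-- The increasing list of the positions selected by the mask `b`. -/
def maskList {n : ℕ} (b : Fin n → Bool) : List (Fin n) := (List.finRange n).filter fun i => b i

theorem mem_maskList {n : ℕ} {b : Fin n → Bool} {i : Fin n} : i ∈ maskList b ↔ b i = true := by
  simp [maskList]

theorem maskList_pairwise {n : ℕ} (b : Fin n → Bool) : (maskList b).Pairwise (· < ·) :=
  (List.pairwise_lt_finRange n).filter _

theorem maskList_snoc {n : ℕ} (b : Fin n → Bool) (t : Bool) :
    maskList (Fin.snoc b t : Fin (n + 1) → Bool) =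
      (maskList b).map Fin.castSucc ++ if t then [Fin.last n] else [] := by
  rw [maskList, List.finRange_succ_last, List.filter_append, List.filter_map]
  congr 1
  · rw [maskList]
    congr 2
    funext i
    simp
  · cases t <;> simp

theorem maskDegree_snoc {n : ℕ} (b : Fin n → Bool) (t : Bool) (d : Fin (n + 1) → ℤ) :
    maskDegree (Fin.snoc b t : Fin (n + 1) → Bool) d =
      maskDegree b (fun i => d i.castSucc) + if t then d (Fin.last n) else 0 := by
  simp [maskDegree, Fin.sum_univ_castSucc]

/-- A new last entry, if selected, must pass all unselected entries before it; otherwise it stays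
put. Growing masks at the end matches iterated brackets, which take the last argument last. -/
theorem maskSign_snoc {n : ℕ} (b : Fin n → Bool) (t : Bool) (d : Fin (n + 1) → ℤ) :
    maskSign (Fin.snoc b t : Fin (n + 1) → Bool) d = maskSign b (fun i => d i.castSucc) *
      if t then (maskDegree (maskNot b) (fun i => d i.castSucc) * d (Fin.last n)).negOnePow
      else 1 := by
  rw [maskSign, Fin.prod_univ_castSucc]
  congr 1
  · refine Finset.prod_congr rfl fun c _ => ?_
    rw [Fin.prod_univ_castSucc, if_neg (fun h => absurd h.1 (Fin.castSucc_lt_last c).not_gt),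
      mul_one]
    simp
  · rw [Fin.prod_univ_castSucc, if_neg (fun h => lt_irrefl _ h.1), mul_one]
    cases t
    · simp
    · simp only [Fin.castSucc_lt_last, Fin.snoc_last, Fin.snoc_castSucc, true_and, if_true,
        maskDegree, Finset.sum_mul, negOnePow_sum, maskNot]
      refine Finset.prod_congr rfl fun a _ => ?_
      rcases Bool.eq_false_or_eq_true (b a) with h | h <;> simp [h]

/-- Masks of length `n + 1` are pairs of a mask of length `n` and a last entry. -/
theorem sum_mask_succ {M : Type*} [AddCommMonoid M] {n : ℕ} (F : (Fin (n + 1) → Bool) → M) :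
    ∑ b, F b = ∑ b : Fin n → Bool, (F (Fin.snoc b true) + F (Fin.snoc b false)) := by
  rw [← (Fin.snocEquiv fun _ : Fin (n + 1) => Bool).sum_comp, Fintype.sum_prod_type,
    Fintype.sum_bool, Finset.sum_add_distrib]
  rfl

theorem sum_map_maskList {n : ℕ} (b : Fin n → Bool) (d : Fin n → ℤ) :
    ((maskList b).map d).sum = maskDegree b d := by
  induction n with
  | zero => simp [maskList, maskDegree]
  | succ n ih =>
    rw [← Fin.snoc_init_self b, maskList_snoc, maskDegree_snoc, ← ih, List.map_append,
      List.sum_append, List.map_map]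
    cases b (Fin.last n) <;> simp [Function.comp_def]

/-- The two rearrangements differ by exchanging the selected block as a whole with its complement.
-/
theorem maskSign_maskNot {n : ℕ} (b : Fin n → Bool) (d : Fin n → ℤ) :
    maskSign (maskNot b) d =
      maskSign b d * (maskDegree b d * maskDegree (maskNot b) d).negOnePow := by
  induction n with
  | zero => simp [maskSign, maskDegree]
  | succ n ih =>
    rw [← Fin.snoc_init_self b]
    generalize Fin.init b = b', b (Fin.last n) = t
    rw [maskNot_snoc, maskSign_snoc, maskSign_snoc, maskDegree_snoc, maskDegree_snoc, ih,
      maskNot_maskNot]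
    cases t
    · simp [mul_add, Int.negOnePow_add, mul_assoc]
    · simp only [Bool.not_true, Bool.false_eq_true, if_false, if_true, mul_one, add_zero, add_mul,
        Int.negOnePow_add, mul_comm (d (Fin.last n))]
      rw [mul_assoc, mul_left_comm _ _ (Int.negOnePow (_ * d (Fin.last n))), Int.units_mul_self,
        mul_one]

end Signs

/-! ### Shuffles correspond to masks -/

section Shuffles

/-- The mask selecting the values that `σ` takes at the first `i` positions. -/
def maskOfPerm {n : ℕ} (i : ℕ) (σ : Equiv.Perm (Fin n)) : Fin n → Bool :=
  fun c => decide ((σ⁻¹ c).val < i)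

theorem maskOfPerm_apply {n : ℕ} (i : ℕ) (σ : Equiv.Perm (Fin n)) (t : Fin n) :
    maskOfPerm i σ (σ t) = decide (t.val < i) := by
  simp [maskOfPerm]

/-- A finite set has only one increasing enumeration. This identifies both blocks of a shuffle with
mask lists. -/
theorem ofFn_eq_maskList {n k : ℕ} {b : Fin n → Bool} {e : Fin k → Fin n} (he : StrictMono e)
    (hb : ∀ c, b c = true ↔ ∃ t, e t = c) : List.ofFn e = maskList b := by
  have p1 : (List.ofFn e).Pairwise (· < ·) := List.pairwise_ofFn.2 fun _ _ h => he h
  have p2 := maskList_pairwise b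
  refine List.Perm.eq_of_pairwise (le := (· < ·)) (fun a b _ _ h h' => absurd h h'.not_gt) p1 p2 ?_
  rw [List.perm_ext_iff_of_nodup (p1.imp ne_of_lt) (p2.imp ne_of_lt)]
  intro c
  rw [List.mem_ofFn', mem_maskList, hb]
  rfl

theorem IsShuffle.ofFn_first {n i j : ℕ} (h : i + j = n) {σ : Equiv.Perm (Fin n)}
    (hσ : IsShuffle i σ) :
    List.ofFn (fun t : Fin i => σ ⟨t, by omega⟩) = maskList (maskOfPerm i σ) := by
  refine ofFn_eq_maskList (fun s t hst => hσ _ _ hst (Or.inl t.2)) fun c => ?_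
  obtain ⟨t, rfl⟩ := σ.surjective c
  rw [maskOfPerm_apply, decide_eq_true_iff]
  refine ⟨fun ht => ⟨⟨t, ht⟩, rfl⟩, ?_⟩
  rintro ⟨s, hs⟩
  rw [← σ.injective hs]
  exact s.2

theorem IsShuffle.ofFn_second {n i j : ℕ} (h : i + j = n) {σ : Equiv.Perm (Fin n)}
    (hσ : IsShuffle i σ) :
    List.ofFn (fun t : Fin j => σ ⟨i + t, by omega⟩) = maskList (maskNot (maskOfPerm i σ)) := by
  refine ofFn_eq_maskList (fun s t hst => hσ _ _ (Nat.add_lt_add_left hst i)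
    (Or.inr (Nat.le_add_right _ _))) fun c => ?_
  obtain ⟨t, rfl⟩ := σ.surjective c
  rw [maskNot, maskOfPerm_apply, Bool.not_eq_true', decide_eq_false_iff_not]
  refine ⟨fun ht => ⟨⟨t - i, by omega⟩, congrArg σ (Fin.ext (Nat.add_sub_cancel' (not_lt.1 ht)))⟩, ?_⟩
  rintro ⟨s, hs⟩
  rw [← σ.injective hs]
  simp

/-- A shuffle is increasing on each block, so its inversions are the pairs with a larger value in
the first block and a smaller one in the second. -/
theorem IsShuffle.koszulSign_eq {n i : ℕ} {σ : Equiv.Perm (Fin n)} (hσ : IsShuffle i σ)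
    (d : Fin n → ℤ) : koszulSign σ d = maskSign (maskOfPerm i σ) d := by
  rw [koszulSign, Finset.prod_filter, maskSign, Finset.prod_comm,
    ← Fintype.prod_prod_type' (f := fun a c => if a < c ∧ maskOfPerm i σ c = true ∧
      maskOfPerm i σ a = false then (d a * d c).negOnePow else 1)]
  refine Fintype.prod_equiv ((Equiv.prodComm _ _).trans (Equiv.prodCongr σ σ)) _ _ fun q => ?_
  obtain ⟨a, c⟩ := q
  simp only [Equiv.trans_apply, Equiv.prodComm_apply, Prod.swap_prod_mk, Equiv.prodCongr_apply,
    Prod.map_apply, maskOfPerm_apply, decide_eq_true_iff, decide_eq_false_iff_not]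
  rw [mul_comm (d (σ a))]
  refine if_congr ⟨fun ⟨h1, h2⟩ => ⟨h2, ?_⟩, fun ⟨h1, h2, h3⟩ => ⟨?_, h1⟩⟩ rfl rfl
  · have h3 : ¬ (c.val < i ∨ i ≤ a.val) := fun h => absurd (hσ a c h1 h) h2.not_gt
    omega
  · rw [Fin.lt_def]
    omega

theorem IsShuffle.ext {n i j : ℕ} (h : i + j = n) {σ τ : Equiv.Perm (Fin n)}
    (hσ : IsShuffle i σ) (hτ : IsShuffle i τ) (hm : maskOfPerm i σ = maskOfPerm i τ) : σ = τ := by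
  have h1 := hσ.ofFn_first h
  have h2 := hσ.ofFn_second h
  rw [hm, ← hτ.ofFn_first h, List.ofFn_inj] at h1
  rw [hm, ← hτ.ofFn_second h, List.ofFn_inj] at h2
  ext t : 1
  by_cases ht : t.val < i
  · exact congrFun h1 ⟨t, ht⟩
  · have := congrFun h2 ⟨t - i, by omega⟩
    simpa [Nat.add_sub_cancel' (not_lt.1 ht)] using this

theorem exists_shuffle {n : ℕ} (b : Fin n → Bool) : ∃ i j : ℕ, i + j = n ∧
    ∃ σ : Equiv.Perm (Fin n), IsShuffle i σ ∧ maskOfPerm i σ = b := by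
  set s : Finset (Fin n) := Finset.univ.filter fun c => b c = true with hs
  refine ⟨s.card, sᶜ.card, by simp, ?_⟩
  have hn : s.card + sᶜ.card = n := by simp
  set e := finSumEquivOfFinset (s := s) rfl rfl with he
  set σ : Equiv.Perm (Fin n) := ((finCongr hn.symm).trans finSumFinEquiv.symm).trans e with hσ
  have v1 : ∀ t : Fin s.card, σ ⟨t, by omega⟩ = s.orderEmbOfFin rfl t := fun t => by
    have : (finSumFinEquiv.symm (finCongr hn.symm ⟨t, by omega⟩) : Fin s.card ⊕ Fin sᶜ.card) =
        Sum.inl t := by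
      rw [Equiv.symm_apply_eq]; rfl
    simp only [hσ, Equiv.trans_apply, this, he, finSumEquivOfFinset_inl]
  have v2 : ∀ t : Fin sᶜ.card, σ ⟨s.card + t, by omega⟩ = sᶜ.orderEmbOfFin rfl t := fun t => by
    have : (finSumFinEquiv.symm (finCongr hn.symm ⟨s.card + t, by omega⟩) :
        Fin s.card ⊕ Fin sᶜ.card) = Sum.inr t := by
      rw [Equiv.symm_apply_eq]; rfl
    simp only [hσ, Equiv.trans_apply, this, he, finSumEquivOfFinset_inr]
  have v2' : ∀ t : Fin n, ∀ h : s.card ≤ t.val,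
      σ t = sᶜ.orderEmbOfFin rfl ⟨t - s.card, by omega⟩ := fun t h => by
    rw [← v2]
    exact congrArg σ (Fin.ext (by simp; omega))
  refine ⟨σ, fun x y hxy h => ?_, funext fun c => ?_⟩
  · rcases h with h | h
    · have e1 := v1 ⟨x, by simp only [Fin.lt_def] at hxy; omega⟩
      have e2 := v1 ⟨y, h⟩
      simp only [Fin.eta] at e1 e2
      rw [e1, e2]
      exact (s.orderEmbOfFin rfl).strictMono hxy
    · rw [v2' x h, v2' y (h.trans hxy.le)]
      refine (sᶜ.orderEmbOfFin rfl).strictMono ?_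
      simp only [Fin.lt_def] at hxy ⊢
      omega
  · obtain ⟨t, rfl⟩ := σ.surjective c
    rw [maskOfPerm_apply, Bool.eq_iff_iff, decide_eq_true_iff]
    have hmem : ∀ c, b c = true ↔ c ∈ s := fun c => by simp [hs]
    rw [hmem]
    by_cases ht : t.val < s.card
    · have e1 := v1 ⟨t, ht⟩
      simp only [Fin.eta] at e1
      rw [e1]
      exact iff_of_true ht (s.orderEmbOfFin_mem rfl _)
    · rw [v2' t (not_lt.1 ht)]
      exact iff_of_false ht (Finset.mem_compl.1 (sᶜ.orderEmbOfFin_mem rfl _))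

open Classical in
/-- A sum over all shuffles of `p + 1` letters with nonempty first part, as a sum over masks. -/
theorem sum_shuffles {M : Type*} [AddCommMonoid M] (p : ℕ) (F : (Fin (p + 1) → Bool) → M)
    (hF : F (fun _ => false) = 0) :
    ∑ y : Finset.HasAntidiagonal.antidiagonal p,
      ∑ σ : Equiv.Perm (Fin (p + 1)) with IsShuffle (y.1.2 + 1) σ,
        F (maskOfPerm (y.1.2 + 1) σ) = ∑ b, F b := by
  have hy : ∀ y : Finset.HasAntidiagonal.antidiagonal p, y.1.2 + 1 + y.1.1 = p + 1 := fun y => by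
    have := Finset.HasAntidiagonal.mem_antidiagonal.1 y.2
    omega
  -- Shuffles here have a first block of size `y.1.2 + 1 ≥ 1`, so they miss the empty mask;
  -- restricting both sums to nonzero terms removes it.
  rw [← Finset.sum_filter_ne_zero (s := Finset.univ) (f := F)]
  rw [Finset.sum_sigma', ← Finset.sum_filter_ne_zero]
  refine Finset.sum_bij (fun x _ => maskOfPerm (x.1.1.2 + 1) x.2) ?_ ?_ ?_ ?_
  · rintro ⟨y, σ⟩ h
    simp only [Finset.mem_filter, Finset.mem_univ, true_and] at h ⊢
    exact h.2
  · rintro ⟨y, σ⟩ h ⟨y', σ'⟩ h' e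
    simp only [Finset.mem_filter, Finset.mem_sigma, Finset.mem_univ, true_and] at h h' e
    -- The size of the mask recovers the length of the first block, hence `y`.
    have l1 := congrArg List.length (h.1.ofFn_first (hy y))
    have l2 := congrArg List.length (h'.1.ofFn_first (hy y'))
    rw [e] at l1
    rw [List.length_ofFn] at l1 l2
    obtain rfl : y = y' := by
      have h1 := hy y
      have h2 := hy y'
      exact Subtype.ext (Prod.ext (by omega) (by omega))
    rw [h.1.ext (hy y) h'.1 e]
  · intro b hb
    simp only [Finset.mem_filter, Finset.mem_univ, true_and] at hb
    obtain ⟨i, j, hij, σ, hσ, rfl⟩ := exists_shuffle b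
    rcases i with _ | i
    · have : maskOfPerm 0 σ = fun _ => false := by
        funext c
        simp [maskOfPerm]
      exact absurd (this ▸ hF) hb
    · refine ⟨⟨⟨(j, i), Finset.HasAntidiagonal.mem_antidiagonal.2 (by omega)⟩, σ⟩, ?_, rfl⟩
      simpa using ⟨hσ, hb⟩
  · rintro ⟨y, σ⟩ h
    rfl

end Shuffles

/-! ### Higher derived brackets in an abstract graded Lie algebra -/

section DerivedBrackets

variable {K : Type u} [Field K] {G : Type v} [AddCommGroup G] [Module K G]
variable {H : Type w} [AddCommGroup H] [Module K H]

/-- A graded Lie algebra `G` with an abelian subalgebra `H`, a projection `P` of `G` onto `H` whose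
kernel is a subalgebra, and an element `π` of degree `-1` in this kernel with `[π, π] = 0`. -/
structure IsDerivedBracketData (B : G →ₗ[K] G →ₗ[K] G) (gr : ℤ → Submodule K G)
    (hr : ℤ → Submodule K H) (ι : H →ₗ[K] G) (P : G →ₗ[K] H) (π : G) : Prop where
  bracket_mem : ∀ {m n : ℤ} {x y : G}, x ∈ gr m → y ∈ gr n → B x y ∈ gr (m + n)
  skew : ∀ {m n : ℤ} {x y : G}, x ∈ gr m → y ∈ gr n → B x y = -((m * n).negOnePow • B y x)
  jacobi : ∀ {l m n : ℤ} {x y z : G}, x ∈ gr l → y ∈ gr m → z ∈ gr n →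
    B (B x y) z = B x (B y z) + (m * n).negOnePow • B (B x z) y
  incl_mem : ∀ {n : ℤ} {f : H}, f ∈ hr n → ι f ∈ gr n
  proj_mem : ∀ {n : ℤ} {x : G}, x ∈ gr n → P x ∈ hr n
  abelian : ∀ f g : H, B (ι f) (ι g) = 0
  proj_bracket : ∀ x y : G, P (B x y) = P (B (ι (P x)) y) + P (B x (ι (P y)))
  pi_mem : π ∈ gr (-1)
  pi_sq : B π π = 0
  proj_pi : P π = 0

/-- The iterated bracket `[⋯[[x, f_1], f_2], …, f_k]`. -/
def nest (B : G →ₗ[K] G →ₗ[K] G) (ι : H →ₗ[K] G) (x : G) (L : List H) : G :=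
  L.foldl (fun y f => B y (ι f)) x

theorem nest_append (B : G →ₗ[K] G →ₗ[K] G) (ι : H →ₗ[K] G) (x : G) (L L' : List H) :
    nest B ι x (L ++ L') = nest B ι (nest B ι x L) L' := List.foldl_append

theorem nest_ofFn_succ (B : G →ₗ[K] G →ₗ[K] G) (ι : H →ₗ[K] G) (x : G) {k : ℕ}
    (f : Fin (k + 1) → H) : nest B ι x (List.ofFn f) =
      B (nest B ι x (List.ofFn fun i => f i.castSucc)) (ι (f (Fin.last k))) := by
  rw [List.ofFn_succ', List.concat_eq_append, nest_append]
  rfl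

theorem nest_zero (B : G →ₗ[K] G →ₗ[K] G) (ι : H →ₗ[K] G) (L : List H) : nest B ι 0 L = 0 := by
  induction L with
  | nil => rfl
  | cons f L ih =>
    change nest B ι (B 0 (ι f)) L = 0
    rw [map_zero, LinearMap.zero_apply, ih]

theorem nest_unit_smul (B : G →ₗ[K] G →ₗ[K] G) (ι : H →ₗ[K] G) (ε : ℤˣ) (x : G) (L : List H) :
    nest B ι (ε • x) L = ε • nest B ι x L := by
  induction L generalizing x with
  | nil => rfl
  | cons f L ih =>
    change nest B ι (B (ε • x) (ι f)) L = ε • nest B ι (B x (ι f)) L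
    rw [← ih]
    congr 1
    exact map_unit_smul_linear (B.flip (ι f)) ε x

namespace IsDerivedBracketData

variable {B : G →ₗ[K] G →ₗ[K] G} {gr : ℤ → Submodule K G} {hr : ℤ → Submodule K H}
variable {ι : H →ₗ[K] G} {P : G →ₗ[K] H} {π : G}

theorem nest_mem (D : IsDerivedBracketData B gr hr ι P π) {m : ℤ} {x : G} (hx : x ∈ gr m)
    {A : Type*} (L : List A) {f : A → H} {d : A → ℤ} (hf : ∀ a, f a ∈ hr (d a)) :
    nest B ι x (L.map f) ∈ gr (m + (L.map d).sum) := by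
  induction L generalizing x m with
  | nil => simpa [nest] using hx
  | cons a L ih =>
    have := ih (D.bracket_mem hx (D.incl_mem (hf a)))
    rwa [add_assoc] at this

theorem swap_two (D : IsDerivedBracketData B gr hr ι P π) {l m n : ℤ} {x : G} (hx : x ∈ gr l)
    {f g : H} (hf : f ∈ hr m) (hg : g ∈ hr n) :
    B (B x (ι f)) (ι g) = (m * n).negOnePow • B (B x (ι g)) (ι f) := by
  rw [D.jacobi hx (D.incl_mem hf) (D.incl_mem hg), D.abelian, map_zero, zero_add]

/-- By `swap_two`, `h` travels from the last place to the first, past every entry of the list. -/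
theorem nest_bracket (D : IsDerivedBracketData B gr hr ι P π) {m n : ℤ} {x : G} (hx : x ∈ gr m)
    {h : H} (hh : h ∈ hr n) {A : Type*} (L : List A) {f : A → H} {d : A → ℤ}
    (hf : ∀ a, f a ∈ hr (d a)) :
    B (nest B ι x (L.map f)) (ι h) =
      (n * (L.map d).sum).negOnePow • nest B ι (B x (ι h)) (L.map f) := by
  induction L generalizing x m with
  | nil => simp [nest]
  | cons a L ih =>
    have := ih (D.bracket_mem hx (D.incl_mem (hf a)))
    rw [D.swap_two hx (hf a) hh, nest_unit_smul, smul_smul, ← Int.negOnePow_add] at this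
    refine this.trans ?_
    rw [List.map_cons, List.sum_cons, mul_add, add_comm, mul_comm (d a)]
    rfl

/-- The iterated bracket of `π` with the entries selected by a mask. -/
theorem nest_mask_mem (D : IsDerivedBracketData B gr hr ι P π) {n : ℕ} (b : Fin n → Bool)
    {f : Fin n → H} {d : Fin n → ℤ} (hf : ∀ i, f i ∈ hr (d i)) :
    nest B ι π ((maskList b).map f) ∈ gr (-1 + maskDegree b d) := by
  rw [← sum_map_maskList]
  exact D.nest_mem D.pi_mem _ hf

theorem nest_mask_snoc (B : G →ₗ[K] G →ₗ[K] G) (ι : H →ₗ[K] G) (x : G) {n : ℕ} (b : Fin n → Bool)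
    (t : Bool) (f : Fin (n + 1) → H) :
    nest B ι x ((maskList (Fin.snoc b t : Fin (n + 1) → Bool)).map f) =
      if t then B (nest B ι x ((maskList b).map fun i => f i.castSucc)) (ι (f (Fin.last n)))
      else nest B ι x ((maskList b).map fun i => f i.castSucc) := by
  rw [maskList_snoc, List.map_append, List.map_map, nest_append]
  cases t <;> rfl

/-- The Leibniz rule for the iterated brackets of `[π, π]`. -/
theorem nest_pi_pi (D : IsDerivedBracketData B gr hr ι P π) {n : ℕ}
    {f : Fin n → H} {d : Fin n → ℤ} (hf : ∀ i, f i ∈ hr (d i)) :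
    nest B ι (B π π) (List.ofFn f) = ∑ b : Fin n → Bool,
      (maskSign b d * (maskDegree b d).negOnePow) •
        B (nest B ι π ((maskList b).map f)) (nest B ι π ((maskList (maskNot b)).map f)) := by
  induction n with
  | zero => simp [nest, maskList, maskSign, maskDegree]
  | succ n ih =>
    rw [nest_ofFn_succ, ih (fun i => hf i.castSucc), sum_mask_succ, ← LinearMap.flip_apply,
      map_sum]
    refine Finset.sum_congr rfl fun b _ => ?_
    rw [map_unit_smul_linear, LinearMap.flip_apply, maskNot_snoc, maskNot_snoc]
    simp only [nest_mask_snoc, maskSign_snoc, maskDegree_snoc, Bool.not_true, Bool.not_false,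
      if_true, if_false, Bool.false_eq_true, add_zero, mul_one]
    -- The last argument joins the right or the left factor. To reach the left one it passes a
    -- factor of degree `-1 + maskDegree (maskNot b)`; the `-1`, coming from `π`, accounts for the
    -- change in `(maskDegree b d).negOnePow`.
    rw [D.jacobi (D.nest_mask_mem b fun i => hf i.castSucc)
      (D.nest_mask_mem (maskNot b) fun i => hf i.castSucc) (D.incl_mem (hf (Fin.last n))),
      smul_add, add_comm, smul_smul]
    congr 2
    rw [add_mul, Int.negOnePow_add, Int.negOnePow_add, neg_one_mul, Int.negOnePow_neg]
    simp only [mul_assoc, mul_left_comm, mul_comm]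

theorem proj_bracket_mask (D : IsDerivedBracketData B gr hr ι P π) {n : ℕ} (b : Fin n → Bool)
    {f : Fin n → H} {d : Fin n → ℤ} (hf : ∀ i, f i ∈ hr (d i)) :
    P (B (nest B ι π ((maskList (maskNot b)).map f))
        (ι (P (nest B ι π ((maskList b).map f))))) =
      ((-1 + maskDegree b d) * maskDegree (maskNot b) d).negOnePow •
        P (nest B ι (B π (ι (P (nest B ι π ((maskList b).map f)))))
          ((maskList (maskNot b)).map f)) := by
  rw [D.nest_bracket D.pi_mem (D.proj_mem (D.nest_mask_mem b hf)) _ hf, map_unit_smul_linear,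
    sum_map_maskList]

/-- With `a` and `c` the degrees of a mask and its complement, the factors come from the Leibniz
rule, from skew symmetry, and from moving the projected factor to the front. -/
theorem negOnePow_mask_cancel (a c : ℤ) :
    a.negOnePow * -(((-1 + a) * (-1 + c)).negOnePow * ((-1 + a) * c).negOnePow) = 1 := by
  rw [mul_add (-1 + a) (-1) c, Int.negOnePow_add, mul_assoc, Int.units_mul_self, mul_one,
    mul_neg_one, Int.negOnePow_neg, Int.negOnePow_add, Int.negOnePow_neg, Int.negOnePow_one,
    neg_one_mul, neg_neg, Int.units_mul_self]

/-- The generalized Jacobi identity for the derived brackets, as a sum over masks. -/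
theorem sum_masks_eq_zero [CharZero K] (D : IsDerivedBracketData B gr hr ι P π) {n : ℕ}
    {f : Fin n → H} {d : Fin n → ℤ} (hf : ∀ i, f i ∈ hr (d i)) :
    ∑ b : Fin n → Bool, maskSign b d •
      P (nest B ι (B π (ι (P (nest B ι π ((maskList b).map f)))))
        ((maskList (maskNot b)).map f)) = 0 := by
  set Y : (Fin n → Bool) → H := fun b =>
    P (nest B ι (B π (ι (P (nest B ι π ((maskList b).map f)))))
      ((maskList (maskNot b)).map f)) with hY
  have h0 : nest B ι (B π π) (List.ofFn f) = 0 := by rw [D.pi_sq, nest_zero]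
  have h1 : ∑ b : Fin n → Bool,
      (maskSign b d • Y b + maskSign (maskNot b) d • Y (maskNot b)) = 0 := by
    rw [← map_zero P, ← h0, D.nest_pi_pi hf, map_sum]
    refine Finset.sum_congr rfl fun b _ => ?_
    rw [map_unit_smul_linear, D.proj_bracket, smul_add]
    congr 1
    -- The projected factor stands on the left; skew symmetry brings it to the right, where
    -- `proj_bracket_mask` applies.
    · rw [D.skew (D.incl_mem (D.proj_mem (D.nest_mask_mem b hf))) (D.nest_mask_mem (maskNot b) hf),
        map_neg, map_unit_smul_linear, D.proj_bracket_mask b hf, smul_smul, ← Units.neg_smul,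
        smul_smul, hY, mul_assoc, negOnePow_mask_cancel, mul_one]
    · have := D.proj_bracket_mask (maskNot b) hf
      rw [maskNot_maskNot] at this
      rw [this, smul_smul, hY, maskSign_maskNot, mul_assoc, ← Int.negOnePow_add]
      simp only [maskNot_maskNot]
      congr 3
      ring
  have hinv : ∑ b : Fin n → Bool, maskSign (maskNot b) d • Y (maskNot b) =
      ∑ b : Fin n → Bool, maskSign b d • Y b :=
    (⟨maskNot, maskNot, maskNot_maskNot, maskNot_maskNot⟩ :
      (Fin n → Bool) ≃ (Fin n → Bool)).sum_comp fun b => maskSign b d • Y b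
  -- Complementation permutes the masks, so the two halves agree and twice the sum vanishes.
  -- Characteristic zero is used here.
  rw [Finset.sum_add_distrib, hinv, ← two_smul K] at h1
  exact (smul_eq_zero.1 h1).resolve_left two_ne_zero

/-- At the last two places this is `swap_two`; an earlier transposition leaves the last argument
alone, which is stripped off by induction. -/
theorem swap_adjacent (D : IsDerivedBracketData B gr hr ι P π) {k : ℕ} (i : Fin k)
    {f : Fin (k + 1) → H} {d : Fin (k + 1) → ℤ} (hf : ∀ i, f i ∈ hr (d i)) :
    nest B ι π (List.ofFn fun s => f (Equiv.swap i.castSucc i.succ s)) =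
      (d i.castSucc * d i.succ).negOnePow • nest B ι π (List.ofFn f) := by
  induction k with
  | zero => exact i.elim0
  | succ k ih =>
    refine Fin.lastCases ?_ (fun j => ?_) i
    · have e : ∀ j : Fin k, Equiv.swap (Fin.last k).castSucc (Fin.last k).succ
          j.castSucc.castSucc = j.castSucc.castSucc := fun j =>
        Equiv.swap_apply_of_ne_of_ne (by simp [Fin.ext_iff]; omega) (by simp [Fin.ext_iff]; omega)
      have m : nest B ι π (List.ofFn fun j : Fin k => f j.castSucc.castSucc) ∈
          gr (-1 + ((List.finRange k).map fun j => d j.castSucc.castSucc).sum) := by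
        rw [List.ofFn_eq_map]
        exact D.nest_mem D.pi_mem _ fun j => hf _
      rw [nest_ofFn_succ, nest_ofFn_succ, nest_ofFn_succ, nest_ofFn_succ]
      simp only [e, ← Fin.succ_last, Equiv.swap_apply_left, Equiv.swap_apply_right]
      rw [D.swap_two m (hf _) (hf _), mul_comm]
    · have e : ∀ s : Fin (k + 1), Equiv.swap j.castSucc.castSucc j.castSucc.succ s.castSucc =
          (Equiv.swap j.castSucc j.succ s).castSucc := fun s => by
        rw [← Fin.castSucc_succ, (Fin.castSucc_injective _).map_swap]
      have e' : Equiv.swap j.castSucc.castSucc j.castSucc.succ (Fin.last (k + 1)) =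
          Fin.last (k + 1) :=
        Equiv.swap_apply_of_ne_of_ne (by simp [Fin.ext_iff]; omega) (by simp [Fin.ext_iff]; omega)
      rw [nest_ofFn_succ, nest_ofFn_succ B ι π f]
      simp only [e, e']
      rw [ih j (f := fun s => f s.castSucc) (d := fun s => d s.castSucc) fun s => hf _,
        ← LinearMap.flip_apply, map_unit_smul_linear, LinearMap.flip_apply, Fin.castSucc_succ]

theorem symmetric (D : IsDerivedBracketData B gr hr ι P π) {k : ℕ}
    (σ : Equiv.Perm (Fin (k + 1))) {f : Fin (k + 1) → H} {d : Fin (k + 1) → ℤ}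
    (hf : ∀ i, f i ∈ hr (d i)) :
    nest B ι π (List.ofFn fun s => f (σ s)) = koszulSign σ d • nest B ι π (List.ofFn f) := by
  -- Adjacent transpositions generate the symmetric group, already as a monoid.
  have hσ : σ ∈ Submonoid.closure (Set.range fun i : Fin k => Equiv.swap i.castSucc i.succ) := by
    rw [Equiv.Perm.mclosure_swap_castSucc_succ]
    exact Submonoid.mem_top σ
  induction hσ using Submonoid.closure_induction_right with
  | one => simp [koszulSign_one]
  | mul_right σ _ τ hτ ih =>
    obtain ⟨i, rfl⟩ := hτ
    rw [koszulSign_mul_swap, mul_comm, ← smul_smul, ← ih]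
    exact D.swap_adjacent i (f := fun s => f (σ s)) (d := fun s => d (σ s)) fun s => hf _

open Classical in
/-- The generalized Jacobi identity for the derived brackets, as a sum over shuffles. -/
theorem sum_shuffles_eq_zero [CharZero K] (D : IsDerivedBracketData B gr hr ι P π) {p : ℕ}
    {f : Fin (p + 1) → H} {d : Fin (p + 1) → ℤ} (hf : ∀ i, f i ∈ hr (d i))
    (F : ∀ y : Finset.HasAntidiagonal.antidiagonal p, (Fin (p + 1) → H) → H)
    (hF : ∀ (y : Finset.HasAntidiagonal.antidiagonal p) (g : Fin (p + 1) → H), F y g =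
      P (nest B ι π (P (nest B ι π (List.ofFn fun t : Fin (y.1.2 + 1) => g ⟨t, by
          have := Finset.HasAntidiagonal.mem_antidiagonal.1 y.2; omega⟩)) ::
        List.ofFn fun t : Fin y.1.1 => g ⟨y.1.2 + 1 + t, by
          have := Finset.HasAntidiagonal.mem_antidiagonal.1 y.2; omega⟩))) :
    ∑ y : Finset.HasAntidiagonal.antidiagonal p,
      ∑ σ : Equiv.Perm (Fin (p + 1)) with IsShuffle (y.1.2 + 1) σ,
        koszulSign σ d • F y (fun s => f (σ s)) = 0 := by
  rw [← D.sum_masks_eq_zero hf]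
  rw [← sum_shuffles]
  · refine Finset.sum_congr rfl fun y _ => Finset.sum_congr rfl fun σ hσ => ?_
    have hσ := (Finset.mem_filter.1 hσ).2
    have hy : y.1.2 + 1 + y.1.1 = p + 1 := by
      have := Finset.HasAntidiagonal.mem_antidiagonal.1 y.2
      omega
    rw [hσ.koszulSign_eq, hF, ← hσ.ofFn_first hy, ← hσ.ofFn_second hy, List.map_ofFn,
      List.map_ofFn]
    rfl
  -- The empty mask contributes a nested bracket containing `P π = 0`.
  · have : maskList (fun _ : Fin (p + 1) => false) = [] := by simp [maskList]
    rw [this]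
    change _ • P (nest B ι (B π (ι (P π))) _) = 0
    rw [D.proj_pi, map_zero, map_zero]
    rw [nest_zero, map_zero, smul_zero]

end IsDerivedBracketData

end DerivedBrackets

/-! ### Compatibility of cochain operations with maps of degree zero -/

section Functoriality

variable {K : Type u} [Field K]
variable {V : ℤ → Type v} [∀ i, AddCommGroup (V i)] [∀ i, Module K (V i)]
variable {V' : ℤ → Type v'} [∀ i, AddCommGroup (V' i)] [∀ i, Module K (V' i)]
variable {W : ℤ → Type w} [∀ i, AddCommGroup (W i)] [∀ i, Module K (W i)]
variable {W' : ℤ → Type w'} [∀ i, AddCommGroup (W' i)] [∀ i, Module K (W' i)]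

/-- The map `f ↦ ψ ∘ f ∘ (φ ⊗ ⋯ ⊗ φ)` on formal sums of multilinear maps. -/
def famMap (φ : ∀ i, V' i →ₗ[K] V i) (ψ : ∀ i, W i →ₗ[K] W' i) : Fam K V W →ₗ[K] Fam K V' W' where
  toFun f k := (DirectSum.lmap ψ).compMultilinearMap
    ((f k).compLinearMap fun _ => DirectSum.lmap φ)
  map_add' f g := funext fun k => MultilinearMap.ext fun a => by simp
  map_smul' c f := funext fun k => MultilinearMap.ext fun a => by simp

theorem famMap_mem (φ : ∀ i, V' i →ₗ[K] V i) (ψ : ∀ i, W i →ₗ[K] W' i) {n : ℤ} {f : Fam K V W}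
    (hf : f ∈ cochain K V W n) : famMap φ ψ f ∈ cochain K V' W' n :=
  (cochainMap K φ ψ n ⟨f, hf⟩).2

theorem lmap_koszul (φ : ∀ i, V' i →ₗ[K] V i) (n : ℤ) (a : Tot V') :
    DirectSum.lmap φ (koszul K V' n a) = koszul K V n (DirectSum.lmap φ a) := by
  have : DirectSum.lmap φ ∘ₗ koszul K V' n = koszul K V n ∘ₗ DirectSum.lmap φ := by
    ext i x : 2
    simp only [koszul, LinearMap.comp_apply, DirectSum.lmap_lof, LinearMap.smul_apply,
      LinearMap.id_apply, map_unit_smul_linear]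
  exact LinearMap.congr_fun this a

/-- A linear map of degree `0` compatible with two families is compatible with their squares. -/
theorem lmap_diamond_self (θ : ∀ i, V' i →ₗ[K] V i) (n : ℤ) {φ' : Fam K V' V'} {φ : Fam K V V}
    (h : ∀ k a, DirectSum.lmap θ (φ' k a) = φ k fun t => DirectSum.lmap θ (a t)) (p : ℕ)
    (a : ℕ → Tot V') :
    DirectSum.lmap θ (evalSeq (diamond K V' n φ' φ') p a) =
      evalSeq (diamond K V n φ φ) p (fun t => DirectSum.lmap θ (a t)) := by
  rw [evalSeq_diamond, evalSeq_diamond, map_sum]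
  refine Finset.sum_congr rfl fun x _ => ?_
  rw [map_sum]
  refine Finset.sum_congr rfl fun i _ => ?_
  rw [evalSeq, h]
  refine congrArg (φ x.1) (funext fun t => ?_)
  simp only [insertSeq]
  split_ifs
  · exact lmap_koszul θ n _
  · exact h _ _
  · rfl

end Functoriality

/-! ### The splitting of `V̄ ⊕ V`, and the abelian subalgebra with its projection -/

section Double

variable {K : Type u} [Field K]
variable {V : ℤ → Type v} [∀ i, AddCommGroup (V i)] [∀ i, Module K (V i)]

variable (K V) in
/-- The projection of `V̄ ⊕ V` onto `V̄`. -/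
def fstTot : Tot (Double V) →ₗ[K] Tot V := DirectSum.lmap fun i => LinearMap.fst K (V i) (V i)

variable (K V) in
/-- The projection of `V̄ ⊕ V` onto `V`. -/
def sndTot : Tot (Double V) →ₗ[K] Tot V := DirectSum.lmap fun i => LinearMap.snd K (V i) (V i)

variable (K V) in
/-- The inclusion of `V̄` in `V̄ ⊕ V`. -/
def inlTot : Tot V →ₗ[K] Tot (Double V) := DirectSum.lmap fun i => LinearMap.inl K (V i) (V i)

variable (K V) in
/-- The inclusion of `V` in `V̄ ⊕ V`. -/
def inrTot : Tot V →ₗ[K] Tot (Double V) := DirectSum.lmap fun i => LinearMap.inr K (V i) (V i)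

theorem fstTot_inlTot (a : Tot V) : fstTot K V (inlTot K V a) = a := by
  have : fstTot K V ∘ₗ inlTot K V = LinearMap.id := by
    ext i x : 2
    simp [fstTot, inlTot, DirectSum.lmap_lof]
  exact LinearMap.congr_fun this a

theorem sndTot_inlTot (a : Tot V) : sndTot K V (inlTot K V a) = 0 := by
  have : sndTot K V ∘ₗ inlTot K V = 0 := by
    ext i x : 2
    simp [sndTot, inlTot, DirectSum.lmap_lof]
  exact LinearMap.congr_fun this a

theorem fstTot_inrTot (a : Tot V) : fstTot K V (inrTot K V a) = 0 := by
  have : fstTot K V ∘ₗ inrTot K V = 0 := by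
    ext i x : 2
    simp [fstTot, inrTot, DirectSum.lmap_lof]
  exact LinearMap.congr_fun this a

theorem sndTot_inrTot (a : Tot V) : sndTot K V (inrTot K V a) = a := by
  have : sndTot K V ∘ₗ inrTot K V = LinearMap.id := by
    ext i x : 2
    simp [sndTot, inrTot, DirectSum.lmap_lof]
  exact LinearMap.congr_fun this a

theorem inlTot_add_inrTot (x : Tot (Double V)) :
    inlTot K V (fstTot K V x) + inrTot K V (sndTot K V x) = x := by
  have : inlTot K V ∘ₗ fstTot K V + inrTot K V ∘ₗ sndTot K V = LinearMap.id := by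
    refine DirectSum.linearMap_ext K fun i => LinearMap.ext fun x => ?_
    simp only [fstTot, sndTot, inlTot, inrTot, LinearMap.comp_apply, LinearMap.add_apply,
      DirectSum.lmap_lof, LinearMap.id_apply, ← map_add]
    congr 1
    simp
  exact LinearMap.congr_fun this x

variable (K V) in
/-- Extension by zero of a map on `V̄`, followed by the inclusion of `V`. -/
def inclFam : Fam K V V →ₗ[K] Fam K (Double V) (Double V) :=
  famMap (fun i => LinearMap.fst K (V i) (V i)) (fun i => LinearMap.inr K (V i) (V i))

variable (K V) in
/-- Restriction to `V̄`, followed by the projection to `V`. -/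
def projFam : Fam K (Double V) (Double V) →ₗ[K] Fam K V V :=
  famMap (fun i => LinearMap.inl K (V i) (V i)) (fun i => LinearMap.snd K (V i) (V i))

theorem inclFam_apply (φ : Fam K V V) (k : ℕ) (a : Fin (k + 1) → Tot (Double V)) :
    inclFam K V φ k a = inrTot K V (φ k fun t => fstTot K V (a t)) := rfl

theorem projFam_apply (φ : Fam K (Double V) (Double V)) (k : ℕ) (a : Fin (k + 1) → Tot V) :
    projFam K V φ k a = sndTot K V (φ k fun t => inlTot K V (a t)) := rfl

theorem inclFam_mem {n : ℤ} {φ : Fam K V V} (hφ : φ ∈ cochain K V V n) :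
    inclFam K V φ ∈ cochain K (Double V) (Double V) n := famMap_mem _ _ hφ

theorem projFam_mem {n : ℤ} {φ : Fam K (Double V) (Double V)}
    (hφ : φ ∈ cochain K (Double V) (Double V) n) : projFam K V φ ∈ cochain K V V n :=
  famMap_mem _ _ hφ

theorem evalSeq_inclFam (φ : Fam K V V) (k : ℕ) (a : ℕ → Tot (Double V)) :
    evalSeq (inclFam K V φ) k a = inrTot K V (evalSeq φ k fun t => fstTot K V (a t)) := rfl

theorem evalSeq_projFam (φ : Fam K (Double V) (Double V)) (k : ℕ) (a : ℕ → Tot V) :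
    evalSeq (projFam K V φ) k a = sndTot K V (evalSeq φ k fun t => inlTot K V (a t)) := rfl

/-- On arguments from `V̄`, split the inner value of `ψ`. Its `V` part is the value of `ιPψ`. Its
`V̄` part leaves `φ` with arguments from `V̄` only, where after projection to `V` it acts as `ιPφ`.
-/
theorem projFam_diamond (n : ℤ) (φ ψ : Fam K (Double V) (Double V)) :
    projFam K V (diamond K (Double V) n φ ψ) =
      projFam K V (diamond K (Double V) n (inclFam K V (projFam K V φ)) ψ) +
        projFam K V (diamond K (Double V) n φ (inclFam K V (projFam K V ψ))) := by
  refine fam_ext fun p a => ?_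
  change _ = evalSeq _ p a + evalSeq _ p a
  simp only [evalSeq_projFam, evalSeq_diamond, map_sum, ← Finset.sum_add_distrib]
  refine Finset.sum_congr rfl fun x _ => Finset.sum_congr rfl fun i hi => ?_
  have hi := Finset.mem_range.1 hi
  set b : ℕ → Tot (Double V) := fun t => inlTot K V (a t) with hb
  set c := insertSeq n i x.2 (0 : Fam K (Double V) (Double V)) b with hc
  set z := evalSeq ψ x.2 fun t => b (i + t) with hz
  rw [insertSeq_eq_update, insertSeq_eq_update n i x.2 (inclFam K V (projFam K V ψ)), ← hc, ← hz]
  have e1 : evalSeq (inclFam K V (projFam K V ψ)) x.2 (fun t => b (i + t)) =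
      inrTot K V (sndTot K V z) := by
    rw [evalSeq_inclFam, evalSeq_projFam]
    simp only [hb, fstTot_inlTot]
    rfl
  rw [e1]
  conv_lhs => rw [← inlTot_add_inrTot (K := K) z]
  rw [evalSeq_update_add _ _ _ hi, map_add]
  congr 1
  rw [evalSeq_inclFam, evalSeq_projFam, sndTot_inrTot]
  congr 1
  refine evalSeq_congr _ fun t _ => ?_
  by_cases ht : t = i
  · subst ht
    simp
  · simp only [Function.update_of_ne ht, hc, insertSeq, if_neg ht, hb]
    split_ifs
    · rw [inlTot, ← lmap_koszul]
      exact congrArg _ (fstTot_inlTot _).symm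
    · rw [fstTot_inlTot]

/-- The inner map takes values in `V`, and the outer one vanishes as soon as one argument lies in
`V`. -/
theorem diamond_inclFam_inclFam (n : ℤ) (φ ψ : Fam K V V) :
    diamond K (Double V) n (inclFam K V φ) (inclFam K V ψ) = 0 := by
  refine fam_ext fun p a => ?_
  rw [evalSeq_diamond]
  refine Finset.sum_eq_zero fun x _ => Finset.sum_eq_zero fun i hi => ?_
  rw [evalSeq_inclFam, evalSeq, MultilinearMap.map_coord_zero _ ⟨i, Finset.mem_range.1 hi⟩,
    map_zero]
  simp [insertSeq, evalSeq_inclFam, fstTot_inrTot]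

end Double

/-! ### The square of `π` vanishes -/

section AInfinity

variable {K : Type u} [Field K]
variable {V : ℤ → Type v} [∀ i, AddCommGroup (V i)] [∀ i, Module K (V i)]

theorem AInfinityStructure.diamond_self (A : AInfinityStructure K V) :
    diamond K V (-1) A.μ.1 A.μ.1 = 0 := by
  funext p
  refine multilinear_ext_homog fun d a ha => ?_
  refine Eq.trans ?_ (A.relation p d a ha)
  simp only [diamond, sum_apply]
  refine Finset.sum_congr rfl fun x _ => Finset.sum_congr rfl fun i _ => ?_
  rw [MultilinearMap.compLinearMap_apply, Finset.sum_filter, negOnePow_sum, ← map_unit_smul]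
  congr 1
  funext t
  split_ifs
  · rw [koszul_of_mem_homog _ (ha t), neg_one_mul, Int.negOnePow_neg]
  · simp

theorem fstTot_doubleFam (μ : Fam K V V) (k : ℕ) (a : Fin (k + 1) → Tot (Double V)) :
    fstTot K V (doubleFam μ k a) = μ k fun t => fstTot K V (a t) := by
  change fstTot K V (inlTot K V _ + inrTot K V _) = _
  rw [map_add, fstTot_inlTot, fstTot_inrTot, add_zero]
  rfl

/-- Multilinear expansion of `μ(x + a)` gives all subsets `S`; removing `S = ∅` removes `μ(a)`. -/
theorem sndTot_doubleFam (μ : Fam K V V) (k : ℕ) (a : Fin (k + 1) → Tot (Double V)) :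
    sndTot K V (doubleFam μ k a) =
      μ k (fun t => sndTot K V (a t) + fstTot K V (a t)) - μ k fun t => fstTot K V (a t) := by
  change sndTot K V (inlTot K V _ + inrTot K V _) = _
  rw [map_add, sndTot_inlTot, sndTot_inrTot, zero_add, sum_apply, eq_sub_iff_add_eq]
  refine Eq.trans ?_ ((μ k).map_add_univ (fun t => sndTot K V (a t))
    (fun t => fstTot K V (a t))).symm
  rw [← Finset.sum_filter_add_sum_filter_not Finset.univ Finset.Nonempty]
  congr 1
  · refine Finset.sum_congr rfl fun S _ => ?_
    rw [MultilinearMap.compLinearMap_apply]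
    congr 1
    funext t
    by_cases h : t ∈ S <;> simp [h, fstTot, sndTot]
  · have : (Finset.univ.filter fun S : Finset (Fin (k + 1)) => ¬ S.Nonempty) = {∅} := by
      ext S
      simp
    rw [this, Finset.sum_singleton, Finset.piecewise_empty]

variable (K V) in
/-- The addition map from `V̄ ⊕ V` to `V`. -/
def addTot : Tot (Double V) →ₗ[K] Tot V :=
  DirectSum.lmap fun i => LinearMap.snd K (V i) (V i) + LinearMap.fst K (V i) (V i)

theorem addTot_apply (x : Tot (Double V)) : addTot K V x = sndTot K V x + fstTot K V x := by
  have : addTot K V = sndTot K V + fstTot K V := by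
    refine DirectSum.linearMap_ext K fun i => LinearMap.ext fun x => ?_
    simp only [fstTot, sndTot, addTot, LinearMap.comp_apply, LinearMap.add_apply,
      DirectSum.lmap_lof, map_add]
  exact LinearMap.congr_fun this x

/-- The projection to `V̄` and the addition map both intertwine `doubleFam A.μ.1` with `A.μ.1`, so
both send its square to zero; together they determine an element of `V̄ ⊕ V`. -/
theorem diamond_doubleFam (A : AInfinityStructure K V) :
    diamond K (Double V) (-1) (doubleFam A.μ.1) (doubleFam A.μ.1) = 0 := by
  refine fam_ext fun p a => ?_
  have h1 : fstTot K V (evalSeq (diamond K (Double V) (-1) (doubleFam A.μ.1) (doubleFam A.μ.1))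
      p a) = 0 := by
    rw [fstTot, lmap_diamond_self (φ := A.μ.1) _ _ (fun k a => fstTot_doubleFam A.μ.1 k a),
      A.diamond_self]
    rfl
  have h2 : addTot K V (evalSeq (diamond K (Double V) (-1) (doubleFam A.μ.1) (doubleFam A.μ.1))
      p a) = 0 := by
    rw [addTot, lmap_diamond_self (φ := A.μ.1), A.diamond_self]
    · rfl
    · intro k a
      change addTot K V _ = A.μ.1 k fun t => addTot K V (a t)
      simp only [addTot_apply, sndTot_doubleFam, fstTot_doubleFam, sub_add_cancel]
  rw [addTot_apply, h1, add_zero] at h2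
  rw [← inlTot_add_inrTot (K := K) (evalSeq (diamond K (Double V) (-1) _ _) p a), h1, h2,
    map_zero, map_zero, add_zero]
  rfl

theorem projFam_doubleFam (μ : Fam K V V) : projFam K V (doubleFam μ) = 0 := by
  refine fam_ext fun p a => ?_
  rw [evalSeq_projFam, evalSeq, sndTot_doubleFam]
  simp only [sndTot_inlTot, zero_add, sub_self]
  rfl

end AInfinity

/-! ### The weight filtration behind the arity bound -/

section Filtration

variable {K : Type u} [Field K]
variable {V : ℤ → Type v} [∀ i, AddCommGroup (V i)] [∀ i, Module K (V i)]

variable (K V) in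
/-- The increasing filtration `0 ⊆ V ⊆ V̄ ⊕ V`, with `V` in filtration degree `0`. -/
def doubleFiltration (j : ℤ) : Submodule K (Tot (Double V)) :=
  if j < 0 then ⊥ else if j = 0 then LinearMap.ker (fstTot K V) else ⊤

theorem doubleFiltration_of_neg {j : ℤ} (h : j < 0) : doubleFiltration K V j = ⊥ := if_pos h

theorem doubleFiltration_zero : doubleFiltration K V 0 = LinearMap.ker (fstTot K V) := by
  simp [doubleFiltration]

theorem doubleFiltration_of_pos {j : ℤ} (h : 0 < j) : doubleFiltration K V j = ⊤ := by
  simp [doubleFiltration, h.not_gt, h.ne']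

theorem koszul_mem_doubleFiltration (m j : ℤ) {a : Tot (Double V)}
    (ha : a ∈ doubleFiltration K V j) : koszul K (Double V) m a ∈ doubleFiltration K V j := by
  rcases lt_trichotomy j 0 with h | rfl | h
  · rw [doubleFiltration_of_neg h, Submodule.mem_bot] at ha ⊢
    rw [ha, map_zero]
  · rw [doubleFiltration_zero, LinearMap.mem_ker] at ha ⊢
    rw [fstTot, lmap_koszul]
    exact (congrArg _ ha).trans (map_zero _)
  · rw [doubleFiltration_of_pos h]
    trivial

variable (K V) in
/-- The families all of whose components shift the filtration of `V̄ ⊕ V` by `n`. -/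
def filteredFam (n : ℤ) : Submodule K (Fam K (Double V) (Double V)) where
  carrier := {φ | ∀ (k : ℕ) (d : Fin (k + 1) → ℤ) (a : Fin (k + 1) → Tot (Double V)),
    (∀ i, a i ∈ doubleFiltration K V (d i)) → φ k a ∈ doubleFiltration K V ((∑ i, d i) + n)}
  add_mem' hφ hψ k d a ha := add_mem (hφ k d a ha) (hψ k d a ha)
  zero_mem' _ _ _ _ := zero_mem _
  smul_mem' c _ hφ k d a ha := Submodule.smul_mem _ c (hφ k d a ha)

/-- An argument of negative filtration degree is zero, and then so is the value. -/
theorem mem_filteredFam_of_nonneg {n : ℤ} {φ : Fam K (Double V) (Double V)}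
    (h : ∀ (k : ℕ) (d : Fin (k + 1) → ℤ) (a : Fin (k + 1) → Tot (Double V)), (∀ i, 0 ≤ d i) →
      (∀ i, a i ∈ doubleFiltration K V (d i)) →
        φ k a ∈ doubleFiltration K V ((∑ i, d i) + n)) : φ ∈ filteredFam K V n := by
  intro k d a ha
  by_cases hd : ∀ i, 0 ≤ d i
  · exact h k d a hd ha
  · obtain ⟨i, hi⟩ := not_forall.1 hd
    have h0 := ha i
    rw [doubleFiltration_of_neg (not_le.1 hi), Submodule.mem_bot] at h0
    rw [MultilinearMap.map_coord_zero _ i h0]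
    exact zero_mem _

theorem diamond_mem_filteredFam (r : ℤ) {m n : ℤ} {φ ψ : Fam K (Double V) (Double V)}
    (hφ : φ ∈ filteredFam K V m) (hψ : ψ ∈ filteredFam K V n) :
    diamond K (Double V) r φ ψ ∈ filteredFam K V (m + n) := by
  intro p d a ha
  simp only [diamond, sum_apply]
  refine Submodule.sum_mem _ fun x _ => Submodule.sum_mem _ fun i _ => ?_
  have h := Finset.HasAntidiagonal.mem_antidiagonal.1 x.2
  have ha' : ∀ t : Fin (p + 1), (if t.val < i.val then koszul K (Double V) r else LinearMap.id)
      (a t) ∈ doubleFiltration K V (d t) := fun t => by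
    split_ifs
    · exact koszul_mem_doubleFiltration r _ (ha t)
    · exact ha t
  have := hφ x.1.1 (insertArgs h i (fun e => (∑ t, e t) + n) d)
    (insertArgs h i (ψ x.1.2) fun t : Fin (p + 1) =>
      (if t.val < i.val then koszul K (Double V) r else LinearMap.id) (a t)) (by
    intro j
    unfold insertArgs
    split_ifs
    · exact ha' _
    · exact hψ _ _ _ fun t => ha' _
    · exact ha' _)
  rw [sum_insertArgs] at this
  rw [add_comm m n, ← add_assoc]
  exact this

theorem doubleFam_mem_filteredFam (μ : Fam K V V) : doubleFam μ ∈ filteredFam K V 0 := by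
  refine mem_filteredFam_of_nonneg fun k d a hd ha => ?_
  rw [add_zero]
  rcases (Finset.sum_nonneg fun i (_ : i ∈ Finset.univ) => hd i).eq_or_lt with h | h
  · rw [← h, doubleFiltration_zero, LinearMap.mem_ker, fstTot_doubleFam]
    have h0 := (Finset.sum_eq_zero_iff_of_nonneg fun i _ => hd i).1 h.symm 0 (Finset.mem_univ _)
    have := ha 0
    rw [h0, doubleFiltration_zero, LinearMap.mem_ker] at this
    exact MultilinearMap.map_coord_zero _ 0 this
  · rw [doubleFiltration_of_pos h]
    trivial

/-- If the total weight is `0`, all arguments lie in `V` and the map vanishes. If it is `1`, it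
suffices that values lie in `V`; beyond that there is no condition. -/
theorem inclFam_mem_filteredFam (φ : Fam K V V) : inclFam K V φ ∈ filteredFam K V (-1) := by
  refine mem_filteredFam_of_nonneg fun k d a hd ha => ?_
  rw [inclFam_apply]
  rcases (Finset.sum_nonneg fun i (_ : i ∈ Finset.univ) => hd i).eq_or_lt with h | h
  · have h0 := (Finset.sum_eq_zero_iff_of_nonneg fun i _ => hd i).1 h.symm 0 (Finset.mem_univ _)
    have := ha 0
    rw [h0, doubleFiltration_zero, LinearMap.mem_ker] at this
    rw [MultilinearMap.map_coord_zero _ 0 this, map_zero]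
    exact zero_mem _
  · rcases (show 0 ≤ (∑ i, d i) + -1 by omega).eq_or_lt with h' | h'
    · rw [← h', doubleFiltration_zero, LinearMap.mem_ker, fstTot_inrTot]
    · rw [doubleFiltration_of_pos h']
      trivial

theorem projFam_eq_zero_of_mem {n : ℤ} {φ : Fam K (Double V) (Double V)}
    (hφ : φ ∈ filteredFam K V n) {p : ℕ} (hp : (p : ℤ) + 1 + n < 0) : projFam K V φ p = 0 := by
  refine MultilinearMap.ext fun a => ?_
  have := hφ p (fun _ => 1) (fun t => inlTot K V (a t)) fun i => by
    rw [doubleFiltration_of_pos one_pos]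
    trivial
  rw [doubleFiltration_of_neg (by simpa using hp), Submodule.mem_bot] at this
  rw [projFam_apply, this, map_zero]
  rfl

end Filtration

/-! ### The `L_∞`-structure on `ℋ` and its arity bound -/

section HigherDerived

variable {K : Type u} [Field K]
variable {V : ℤ → Type v} [∀ i, AddCommGroup (V i)] [∀ i, Module K (V i)]

variable (K V) in
/-- The inclusion of `ℋ` in `𝒢`, between total spaces. -/
def totIncl : CochainTot K V →ₗ[K] CochainTot K (Double V) := incl K V

variable (K V) in
/-- The projection of `𝒢` onto `ℋ`, between total spaces. -/
def totProj : CochainTot K (Double V) →ₗ[K] CochainTot K V := proj K V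

theorem totIncl_ofCochain {n : ℤ} {φ : Fam K V V} (hφ : φ ∈ cochain K V V n) :
    totIncl K V (ofCochain n φ hφ) = ofCochain n (inclFam K V φ) (inclFam_mem hφ) :=
  DirectSum.lmap_lof _ _ _

theorem totProj_ofCochain {n : ℤ} {φ : Fam K (Double V) (Double V)}
    (hφ : φ ∈ cochain K (Double V) (Double V) n) :
    totProj K V (ofCochain n φ hφ) = ofCochain n (projFam K V φ) (projFam_mem hφ) :=
  DirectSum.lmap_lof _ _ _

theorem ofCochain_eq_zero {n : ℤ} {φ : Fam K V V} (hφ : φ ∈ cochain K V V n) (h : φ = 0) :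
    ofCochain n φ hφ = 0 := by
  subst h
  exact map_zero (DirectSum.lof K ℤ (fun r => cochain K V V r) n)

theorem cochainTot_induction {p : CochainTot K V → Prop}
    (hom : ∀ n φ h, p (ofCochain n φ h)) (add : ∀ x y, p x → p y → p (x + y))
    (x : CochainTot K V) : p x := by
  induction x using DirectSum.induction_on with
  | zero =>
    have := hom 0 0 (zero_mem _)
    rwa [ofCochain_eq_zero _ rfl] at this
  | of i x => exact hom i x.1 x.2
  | add x y hx hy => exact add x y hx hy

theorem totBracket_totIncl (f g : CochainTot K V) :
    totBracket K (Double V) (totIncl K V f) (totIncl K V g) = 0 := by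
  induction f using cochainTot_induction with
  | add x y hx hy => rw [map_add, map_add, LinearMap.add_apply, hx, hy, add_zero]
  | hom m φ hφ =>
    induction g using cochainTot_induction with
    | add x y hx hy => rw [map_add, map_add, hx, hy, add_zero]
    | hom n ψ hψ =>
      rw [totIncl_ofCochain, totIncl_ofCochain, totBracket_ofCochain]
      refine ofCochain_eq_zero _ ?_
      rw [coe_bracketHom, diamond_inclFam_inclFam, diamond_inclFam_inclFam, smul_zero, sub_zero]

/-- The crossed pairing reassembles commutators: `ιPφ ⋄ ψ` goes with `ψ ⋄ ιPφ`, the second summand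
in the expansion of `ψ ⋄ φ`. -/
theorem sub_unit_smul_of_eq_add {M : Type*} [AddCommGroup M] {a b c a' b' c' : M} (h : a = b + c)
    (h' : a' = b' + c') (ε : ℤˣ) : a - ε • a' = (b - ε • c') + (c - ε • b') := by
  rw [h, h', smul_add]
  abel

theorem totProj_totBracket (x y : CochainTot K (Double V)) :
    totProj K V (totBracket K (Double V) x y) =
      totProj K V (totBracket K (Double V) (totIncl K V (totProj K V x)) y) +
        totProj K V (totBracket K (Double V) x (totIncl K V (totProj K V y))) := by
  induction x using cochainTot_induction with
  | add x x' hx hx' =>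
    simp only [map_add, LinearMap.add_apply] at hx hx' ⊢
    rw [hx, hx']
    abel
  | hom m φ hφ =>
    induction y using cochainTot_induction with
    | add y y' hy hy' =>
      simp only [map_add] at hy hy' ⊢
      rw [hy, hy']
      abel
    | hom n ψ hψ =>
      simp only [totIncl_ofCochain, totProj_ofCochain, totBracket_ofCochain, ofCochain_add]
      refine ofCochain_congr rfl (projFam_mem (bracketHom K (Double V) m n ⟨φ, hφ⟩ ⟨ψ, hψ⟩).2) ?_
      simp only [coe_bracketHom, map_sub, map_unit_smul_linear]
      exact sub_unit_smul_of_eq_add (projFam_diamond n φ ψ) (projFam_diamond m ψ φ) _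

/-- The element `π`, in the total space. -/
def totPi (A : AInfinityStructure K V) : CochainTot K (Double V) :=
  ofCochain (-1) (doubleFam A.μ.1) (doubleFam_mem A.μ.2)

theorem isDerivedBracketData (A : AInfinityStructure K V) :
    IsDerivedBracketData (totBracket K (Double V))
      (homog K fun r => cochain K (Double V) (Double V) r) (homog K fun r => cochain K V V r)
      (totIncl K V) (totProj K V) (totPi A) where
  bracket_mem := totBracket_mem
  skew := totBracket_skew
  jacobi := totBracket_jacobi
  incl_mem hf := by
    obtain ⟨φ, hφ, rfl⟩ := exists_ofCochain hf
    rw [totIncl_ofCochain]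
    exact ofCochain_mem _ _ _
  proj_mem hx := by
    obtain ⟨φ, hφ, rfl⟩ := exists_ofCochain hx
    rw [totProj_ofCochain]
    exact ofCochain_mem _ _ _
  abelian := totBracket_totIncl
  proj_bracket := totProj_totBracket
  pi_mem := ofCochain_mem _ _ _
  pi_sq := by
    rw [totPi, totBracket_ofCochain]
    refine ofCochain_eq_zero _ ?_
    rw [coe_bracketHom, diamond_doubleFam, smul_zero, sub_zero]
  proj_pi := by
    rw [totPi, totProj_ofCochain]
    exact ofCochain_eq_zero _ (projFam_doubleFam _)

/-- The iterated bracket `[⋯[[π, f_1], f_2], …, f_k]` as a multilinear map. -/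
def iterMultilinear (A : AInfinityStructure K V) : ∀ k : ℕ,
    MultilinearMap K (fun _ : Fin k => CochainTot K V) (CochainTot K (Double V))
  | 0 => MultilinearMap.constOfIsEmpty K _ (totPi A)
  | k + 1 => MultilinearMap.uncurryRight
      (((totBracket K (Double V)).compl₂ (totIncl K V)).compMultilinearMap (iterMultilinear A k))

theorem iterMultilinear_succ (A : AInfinityStructure K V) (k : ℕ)
    (f : Fin (k + 1) → CochainTot K V) :
    iterMultilinear A (k + 1) f = totBracket K (Double V)
      (iterMultilinear A k fun i => f i.castSucc) (totIncl K V (f (Fin.last k))) := rfl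

theorem iterMultilinear_eq_iterBracket (A : AInfinityStructure K V) (k : ℕ)
    (f : Fin k → CochainTot K V) : iterMultilinear A k f = iterBracket A k f := by
  induction k with
  | zero => rfl
  | succ k ih =>
    rw [iterMultilinear_succ, ih]
    rfl

theorem iterMultilinear_eq_nest (A : AInfinityStructure K V) (k : ℕ)
    (f : Fin k → CochainTot K V) :
    iterMultilinear A k f =
      nest (totBracket K (Double V)) (totIncl K V) (totPi A) (List.ofFn f) := by
  induction k with
  | zero => rfl
  | succ k ih => rw [iterMultilinear_succ, ih, nest_ofFn_succ]

/-- The higher derived brackets on `ℋ`. -/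
def derivedBrackets (A : AInfinityStructure K V) :
    Fam K (fun r : ℤ => cochain K V V r) (fun r : ℤ => cochain K V V r) := fun k =>
  (totProj K V).compMultilinearMap (iterMultilinear A (k + 1))

theorem derivedBrackets_apply (A : AInfinityStructure K V) (k : ℕ)
    (f : Fin (k + 1) → CochainTot K V) : derivedBrackets A k f =
      totProj K V (nest (totBracket K (Double V)) (totIncl K V) (totPi A) (List.ofFn f)) :=
  congrArg (totProj K V) (iterMultilinear_eq_nest A (k + 1) f)

theorem isLInfinityAlgebra_derivedBrackets [CharZero K] (A : AInfinityStructure K V) :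
    IsLInfinityAlgebra K (fun r : ℤ => cochain K V V r) (derivedBrackets A) where
  degree k d f hf := by
    have D := isDerivedBracketData A
    have := D.proj_mem (D.nest_mem D.pi_mem (List.finRange (k + 1)) hf)
    rw [derivedBrackets_apply, List.ofFn_eq_map, add_comm]
    rwa [← List.ofFn_eq_map (f := d), List.sum_ofFn] at this
  symmetric k σ d f hf := by
    rw [derivedBrackets_apply, derivedBrackets_apply, (isDerivedBracketData A).symmetric σ hf,
      map_unit_smul_linear]
  jacobi p d f hf := by
    refine (isDerivedBracketData A).sum_shuffles_eq_zero hf (fun y g =>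
      insertMap (Finset.HasAntidiagonal.mem_antidiagonal.1 y.2) 0 (derivedBrackets A y.1.1)
        (derivedBrackets A y.1.2) g) fun y g => ?_
    -- Insertion at position `0` makes the inner bracket the head of the argument list.
    rw [insertMap_apply, derivedBrackets_apply, List.ofFn_succ]
    congr 3
    · simp only [insertArgs, lt_irrefl, if_false, if_true]
      rw [derivedBrackets_apply]
      congr 3
      funext t
      simp
    · congr 1
      funext t
      simp only [insertArgs, Fin.not_lt_zero, if_false, Fin.succ_ne_zero]
      congr 1
      ext
      simp
      omega

variable (K V) in
/-- The subspace of `𝒢` spanned by the homogeneous elements shifting the filtration by `n`. -/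
def filteredSpan (n : ℤ) : Submodule K (CochainTot K (Double V)) :=
  Submodule.span K {x | ∃ r φ h, φ ∈ filteredFam K V n ∧ x = ofCochain r φ h}

theorem totBracket_mem_filteredSpan {m n : ℤ} {x y : CochainTot K (Double V)}
    (hx : x ∈ filteredSpan K V m) (hy : y ∈ filteredSpan K V n) :
    totBracket K (Double V) x y ∈ filteredSpan K V (m + n) := by
  have := Submodule.apply_mem_map₂ (totBracket K (Double V)) hx hy
  rw [filteredSpan, filteredSpan, Submodule.map₂_span_span] at this
  refine Submodule.span_mono ?_ this
  rintro _ ⟨_, ⟨r, φ, hr, hφ, rfl⟩, _, ⟨s, ψ, hs, hψ, rfl⟩, rfl⟩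
  refine ⟨_, _, _, ?_, totBracket_ofCochain hr hs⟩
  rw [coe_bracketHom]
  refine sub_mem (diamond_mem_filteredFam _ hφ hψ) (unit_smul_mem _ _ ?_)
  rw [add_comm]
  exact diamond_mem_filteredFam _ hψ hφ

theorem totIncl_mem_filteredSpan (f : CochainTot K V) : totIncl K V f ∈ filteredSpan K V (-1) := by
  induction f using cochainTot_induction with
  | add x y hx hy =>
    rw [map_add]
    exact add_mem hx hy
  | hom n φ hφ =>
    exact Submodule.subset_span ⟨_, _, _, inclFam_mem_filteredFam φ, totIncl_ofCochain hφ⟩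

theorem iterMultilinear_mem_filteredSpan (A : AInfinityStructure K V) (k : ℕ)
    (f : Fin k → CochainTot K V) : iterMultilinear A k f ∈ filteredSpan K V (-k) := by
  induction k with
  | zero =>
    exact Submodule.subset_span ⟨_, _, doubleFam_mem A.μ.2, by
      simpa using doubleFam_mem_filteredFam A.μ.1, rfl⟩
  | succ k ih =>
    rw [iterMultilinear_succ, Nat.cast_succ, neg_add]
    exact totBracket_mem_filteredSpan (ih _) (totIncl_mem_filteredSpan _)

/-- Each of the `p + 1` arguments from `V̄` has weight `1`, so the value lies in weight `p + 1 + m <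
0`, which is zero. -/
theorem totProj_apply_eq_zero {m : ℤ} {x : CochainTot K (Double V)}
    (hx : x ∈ filteredSpan K V m) (n : ℤ) {p : ℕ} (hp : (p : ℤ) + 1 + m < 0) :
    (totProj K V x n : Fam K V V) p = 0 := by
  induction hx using Submodule.span_induction with
  | mem x hx =>
    obtain ⟨r, φ, h, hφ, rfl⟩ := hx
    rw [totProj_ofCochain]
    by_cases hr : r = n
    · subst hr
      refine (congrArg (fun z : cochain K V V r => (z : Fam K V V) p)
        (DirectSum.lof_apply K r _)).trans ?_
      exact projFam_eq_zero_of_mem hφ hp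
    · exact congrArg (fun z : cochain K V V n => (z : Fam K V V) p)
        (show ofCochain r _ (projFam_mem h) n = 0 from
          DirectSum.of_eq_of_ne r n _ (Ne.symm hr))
  | zero => rw [map_zero]; rfl
  | add x y _ _ hx hy =>
    rw [map_add]
    exact (congrArg₂ (· + ·) hx hy).trans (add_zero _)
  | smul c x _ hx =>
    rw [map_smul]
    exact (congrArg (c • ·) hx).trans (smul_zero _)

end HigherDerived

end DiffAInf

theorem theorem4p4 {K : Type*} [Field K] [CharZero K]
    (V : ℤ → Type*) [∀ i, AddCommGroup (V i)] [∀ i, Module K (V i)]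
    (A : DiffAInf.AInfinityStructure K V) :
    ∃ l : DiffAInf.Fam K (fun n : ℤ => DiffAInf.cochain K V V n)
        (fun n : ℤ => DiffAInf.cochain K V V n),
      DiffAInf.IsLInfinityAlgebra K (fun n : ℤ => DiffAInf.cochain K V V n) l ∧
      (∀ (k : ℕ) (f : Fin (k + 1) → DiffAInf.HSpace K V),
        l k f = DiffAInf.proj K V (DiffAInf.iterBracket A (k + 1) f)) ∧
      (∀ (k : ℕ) (f : Fin (k + 1) → DiffAInf.HSpace K V) (n : ℤ) (p : ℕ), p < k →
        (l k f n : DiffAInf.Fam K V V) p = 0) := by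
  refine ⟨DiffAInf.derivedBrackets A, DiffAInf.isLInfinityAlgebra_derivedBrackets A,
    fun k f => congrArg (DiffAInf.totProj K V)
      (DiffAInf.iterMultilinear_eq_iterBracket A (k + 1) f), fun k f n p hp => ?_⟩
  -- Indices `k` and `p` stand for `k + 1` brackets and arity `p + 1`, so the weight is `(p + 1) -
  -- (k + 1) < 0`.
  exact DiffAInf.totProj_apply_eq_zero
    (DiffAInf.iterMultilinear_mem_filteredSpan A (k + 1) f) n (by push_cast; omega)
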